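/- Let $(M,\omega)$ be a compact symplectic manifold of dimension $2n$, $n\ge 1$, with smooth (possibly empty) boundary $\partial M$, and let $\rho\in C^\infty(M)$ be a boundary defining function: $\rho<0$ in the interior of $M$, and $\rho=0$, $d\rho\ne 0$ at every point of $\partial M$. Let $\Omega^k$ be the space of real differential $k$-forms on $M$, smooth up to the boundary (with $\Omega^{k}=0$ for $k<0$). Put $L\eta=\omega\wedge\eta$ and, in local coordinates, $\Lambda\eta=\tfrac12\sum_{i,j}(\omega^{-1})^{ij}\,\iota_{\partial_i}\iota_{\partial_j}\eta$. Let $P^k=\{\eta\in\Omega^k:\Lambda\eta=0\}$ be the space of primitive $k$-forms. For $0\le k<n$ and $\eta\in P^k$ let $\partial_+\eta\in P^{k+1}$ be the primitive form determined by $d\eta=\partial_+\eta+\omega\wedge\xi$ with $\xi\in P^{k-1}$. Below, $\alpha|_{\partial M}=0$ means that the form $\alpha$ vanishes on all of $T_xM$ for every $x\in\partial M$. Put $$\Omega^k_D=\{\eta\in\Omega^k: d(\rho\eta)|_{\partial M}=0\},\qquad P^k_{D_+}=\{\eta\in P^k:\partial_+(\rho\eta)|_{\partial M}=0\},$$ $$H^k(d,D)=\frac{\{\eta\in\Omega^k_D: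 d\eta=0\}}{d\,\Omega^{k-1}_D},\qquad PH^k(\partial_+,D_+)=\frac{\{\eta\in P^k_{D_+}:\partial_+\eta=0\}}{\partial_+P^{k-1}_{D_+}},$$ where the groups are zero for $k<0$ and $PH^k(\partial_+,D_+)$ is taken for $k<n$. The operator $L$ induces maps $L:H^{k}(d,D)\to H^{k+2}(d,D)$. Then for every $0\le k<n$ there is an isomorphism of real vector spaces $$PH^k(\partial_+,D_+)\;\cong\;\ker\bigl[L:H^{k-1}(d,D)\to H^{k+1}(d,D)\bigr]\;\oplus\;\operatorname{coker}\bigl[L:H^{k-2}(d,D)\to H^{k}(d,D)\bigr].$$ -/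

import Mathlib

open Set Topology
open scoped Manifold ContDiff

noncomputable section
namespace SymplecticForms

section Linear

variable {V : Type*} [NormedAddCommGroup V] [NormedSpace ℝ V] {k : ℕ}

open ContinuousAlternatingMap in
/-- The bilinear map `(v, w) ↦ ω(v, w)` of an alternating `2`-form `ω`. -/
def bilinOfTwoForm : (V [⋀^Fin 2]→L[ℝ] ℝ) →L[ℝ] (V →L[ℝ] V →L[ℝ] ℝ) :=
  (ContinuousLinearMap.compL ℝ V (V [⋀^Fin 1]→L[ℝ] ℝ) (V →L[ℝ] ℝ)
      ((ofSubsingletonLIE (𝕜 := ℝ) (E := V) (F := ℝ) (0 : Fin 1)).symm.toContinuousLinearEquiv :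
        (V [⋀^Fin 1]→L[ℝ] ℝ) →L[ℝ] (V →L[ℝ] ℝ))) ∘L
    (curryLeftLI (𝕜 := ℝ) (E := V) (F := ℝ) (n := 1)).toContinuousLinearMap

theorem bilinOfTwoForm_apply (ω₀ : V [⋀^Fin 2]→L[ℝ] ℝ) (v w : V) :
    bilinOfTwoForm ω₀ v w = ω₀ ![v, w] := by
  change ω₀ (Matrix.vecCons v fun _ => w) = _
  congr 1
  ext i
  fin_cases i <;> rfl

theorem bilinOfTwoForm_swap (ω₀ : V [⋀^Fin 2]→L[ℝ] ℝ) (v w : V) :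
    bilinOfTwoForm ω₀ v w = -bilinOfTwoForm ω₀ w v := by
  have h := ω₀.toAlternatingMap.map_swap ![w, v] (Fin.zero_ne_one)
  have e : ![w, v] ∘ Equiv.swap (0 : Fin 2) 1 = ![v, w] := by
    ext i
    fin_cases i <;> simp
  rw [e] at h
  rw [bilinOfTwoForm_apply, bilinOfTwoForm_apply]
  exact h

open ContinuousAlternatingMap in
/-- The wedge product `α ∧ η` of a `1`-form with a `k`-form. -/
def wedgeOne : (V →L[ℝ] ℝ) →L[ℝ] (V [⋀^Fin k]→L[ℝ] ℝ) →L[ℝ] (V [⋀^Fin (k + 1)]→L[ℝ] ℝ) :=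
  (ContinuousLinearMap.compL ℝ (V [⋀^Fin k]→L[ℝ] ℝ) (V →L[ℝ] V [⋀^Fin k]→L[ℝ] ℝ)
      (V [⋀^Fin (k + 1)]→L[ℝ] ℝ) (alternatizeUncurryFinCLM ℝ V ℝ)) ∘L
    (ContinuousLinearMap.smulRightL ℝ V (V [⋀^Fin k]→L[ℝ] ℝ))

open ContinuousAlternatingMap in
theorem wedgeOne_def (α : V →L[ℝ] ℝ) (η : V [⋀^Fin k]→L[ℝ] ℝ) :
    wedgeOne α η = alternatizeUncurryFin (α.smulRight η) := rfl

theorem wedgeOne_apply (α : V →L[ℝ] ℝ) (η : V [⋀^Fin k]→L[ℝ] ℝ) (v : Fin (k + 1) → V) :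
    wedgeOne α η v = ∑ i : Fin (k + 1), (-1) ^ (i : ℕ) • (α (v i) * η (i.removeNth v)) := by
  simp [wedgeOne, ContinuousAlternatingMap.alternatizeUncurryFin_apply]

open ContinuousAlternatingMap in
/-- The wedge product `ω ∧ η` of a `2`-form with a `k`-form, as `½ ∑ᵢ eⁱ ∧ (i_{eᵢ} ω) ∧ η`. It is given
by the usual sum over shuffles, see `wedgeTwo_apply`. -/
def wedgeTwo (ω₀ : V [⋀^Fin 2]→L[ℝ] ℝ) (η : V [⋀^Fin k]→L[ℝ] ℝ) : V [⋀^Fin (k + 2)]→L[ℝ] ℝ :=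
  (1 / 2 : ℝ) • alternatizeUncurryFin (wedgeOne.flip η ∘L bilinOfTwoForm ω₀)

open ContinuousAlternatingMap in
theorem wedgeTwo_apply (ω₀ : V [⋀^Fin 2]→L[ℝ] ℝ) (η : V [⋀^Fin k]→L[ℝ] ℝ)
    (v : Fin (k + 2) → V) :
    wedgeTwo ω₀ η v = ∑ i : Fin (k + 1), ∑ j ≥ i, (-1 : ℝ) ^ (i + j : ℕ) *
      (ω₀ ![v i.castSucc, v j.succ] * η (j.removeNth (i.castSucc.removeNth v))) := by
  have h : (wedgeOne.flip η ∘L bilinOfTwoForm ω₀ : V →L[ℝ] V [⋀^Fin (k + 1)]→L[ℝ] ℝ) =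
      alternatizeUncurryFinCLM ℝ V ℝ ∘L
        ((ContinuousLinearMap.smulRightL ℝ V (V [⋀^Fin k]→L[ℝ] ℝ)).flip η ∘L
          bilinOfTwoForm ω₀) := rfl
  rw [wedgeTwo, h, ContinuousAlternatingMap.smul_apply,
    alternatizeUncurryFin_alternatizeUncurryFinCLM_comp_apply,
    Finset.smul_sum]
  refine Finset.sum_congr rfl fun i _ => ?_
  rw [Finset.smul_sum]
  refine Finset.sum_congr rfl fun j _ => ?_
  have h2 := bilinOfTwoForm_swap ω₀ (v j.succ) (v i.castSucc)
  change (1 / 2 : ℝ) • ((-1 : ℤ) ^ (i + j : ℕ) •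
    (bilinOfTwoForm ω₀ (v i.castSucc) (v j.succ) * _ -
      bilinOfTwoForm ω₀ (v j.succ) (v i.castSucc) * _)) = _
  rw [h2, ← bilinOfTwoForm_apply, zsmul_eq_mul, smul_eq_mul]
  change _ * (_ * (_ * η _ - _ * η _)) = _
  push_cast
  ring

theorem wedgeTwo_add (ω₀ : V [⋀^Fin 2]→L[ℝ] ℝ) (η ζ : V [⋀^Fin k]→L[ℝ] ℝ) :
    wedgeTwo ω₀ (η + ζ) = wedgeTwo ω₀ η + wedgeTwo ω₀ ζ := by
  simp only [wedgeTwo, map_add, ContinuousLinearMap.add_comp,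
    ContinuousAlternatingMap.alternatizeUncurryFin_add, smul_add]

theorem wedgeTwo_smul (ω₀ : V [⋀^Fin 2]→L[ℝ] ℝ) (c : ℝ) (η : V [⋀^Fin k]→L[ℝ] ℝ) :
    wedgeTwo ω₀ (c • η) = c • wedgeTwo ω₀ η := by
  simp only [wedgeTwo, map_smul, ContinuousLinearMap.smul_comp,
    ContinuousAlternatingMap.alternatizeUncurryFin_smul]
  rw [smul_comm]

theorem wedgeTwo_compContinuousLinearMap {W : Type*} [NormedAddCommGroup W] [NormedSpace ℝ W]
    (ω₀ : V [⋀^Fin 2]→L[ℝ] ℝ) (η : V [⋀^Fin k]→L[ℝ] ℝ) (A : W →L[ℝ] V) :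
    wedgeTwo (ω₀.compContinuousLinearMap A) (η.compContinuousLinearMap A) =
      (wedgeTwo ω₀ η).compContinuousLinearMap A := by
  ext v
  rw [ContinuousAlternatingMap.compContinuousLinearMap_apply, wedgeTwo_apply, wedgeTwo_apply]
  refine Finset.sum_congr rfl fun i _ => Finset.sum_congr rfl fun j _ => ?_
  congr 2
  rw [ContinuousAlternatingMap.compContinuousLinearMap_apply]
  congr 1
  ext i
  fin_cases i <;> rfl

/-- The dual Lefschetz operator `Λη = ½ ∑ᵢⱼ (ω⁻¹)ⁱʲ i_{bᵢ} i_{bⱼ} η`, where `ω⁻¹` is the inverse of the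
matrix `(ω(bᵢ, bⱼ))`. It does not depend on the basis `b`. -/
def lefschetzDual {ι : Type*} [Fintype ι] [DecidableEq ι] (b : Module.Basis ι ℝ V)
    (ω₀ : V [⋀^Fin 2]→L[ℝ] ℝ) : (V [⋀^Fin (k + 2)]→L[ℝ] ℝ) →ₗ[ℝ] (V [⋀^Fin k]→L[ℝ] ℝ) where
  toFun η := (1 / 2 : ℝ) • ∑ i, ∑ j,
    (Matrix.of fun i j => ω₀ ![b i, b j])⁻¹ i j • (η.curryLeft (b j)).curryLeft (b i)
  map_add' η ζ := by
    simp only [ContinuousAlternatingMap.curryLeft_add, add_apply, smul_add,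
      Finset.sum_add_distrib]
  map_smul' c η := by
    simp only [ContinuousAlternatingMap.curryLeft_smul, smul_apply,
      Finset.smul_sum, RingHom.id_apply, smul_comm c]

open ContinuousAlternatingMap in
/-- Swapping the two arguments before alternating changes the sign. -/
theorem alternatize_swap (G : V →L[ℝ] V →L[ℝ] V [⋀^Fin k]→L[ℝ] ℝ) :
    alternatizeUncurryFin (alternatizeUncurryFinCLM ℝ V ℝ ∘L G.flip) =
      -alternatizeUncurryFin (alternatizeUncurryFinCLM ℝ V ℝ ∘L G) := by
  rw [eq_neg_iff_add_eq_zero, ← alternatizeUncurryFin_add, ← ContinuousLinearMap.comp_add]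
  exact alternatizeUncurryFin_alternatizeUncurryFinCLM_comp_of_symmetric fun x y => by
    simp [add_comm]

open ContinuousAlternatingMap in
theorem alternatize_wedge_right (B : V →L[ℝ] V →L[ℝ] ℝ) (D : V →L[ℝ] V [⋀^Fin k]→L[ℝ] ℝ)
    (G : V →L[ℝ] V →L[ℝ] V [⋀^Fin (k + 1)]→L[ℝ] ℝ) (hG : ∀ v a, G v a = wedgeOne (B a) (D v)) :
    alternatizeUncurryFin (alternatizeUncurryFinCLM ℝ V ℝ ∘L G) =
      alternatizeUncurryFin (wedgeOne.flip (alternatizeUncurryFin D) ∘L B) := by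
  have key : alternatizeUncurryFinCLM ℝ V ℝ ∘L G.flip =
      -(wedgeOne.flip (alternatizeUncurryFin D) ∘L B) := by
    ext1 a
    let K : V →L[ℝ] V →L[ℝ] V [⋀^Fin k]→L[ℝ] ℝ :=
      (ContinuousLinearMap.smulRightL ℝ V (V [⋀^Fin k]→L[ℝ] ℝ) (B a)) ∘L D
    have h1 : G.flip a = alternatizeUncurryFinCLM ℝ V ℝ ∘L K := by
      ext1 v
      rw [ContinuousLinearMap.flip_apply, hG]
      rfl
    have h2 : alternatizeUncurryFinCLM ℝ V ℝ ∘L K.flip =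
        (B a).smulRight (alternatizeUncurryFin D) := by
      ext1 b
      have : K.flip b = B a b • D := by
        ext1 v
        rfl
      rw [ContinuousLinearMap.comp_apply, this, map_smul]
      rfl
    rw [ContinuousLinearMap.comp_apply, h1, alternatizeUncurryFinCLM_apply, ← neg_neg
      (alternatizeUncurryFin _), ← alternatize_swap, h2]
    rfl
  have h := alternatize_swap G
  rw [key] at h
  rw [← neg_eq_iff_eq_neg.mpr h, ← alternatizeUncurryFinCLM_apply, map_neg, neg_neg]
  rfl

open ContinuousAlternatingMap in
theorem alternatize_wedge_left (D : V →L[ℝ] V [⋀^Fin 2]→L[ℝ] ℝ) (hD : alternatizeUncurryFin D = 0)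
    (η : V [⋀^Fin k]→L[ℝ] ℝ)
    (G : V →L[ℝ] V →L[ℝ] V [⋀^Fin (k + 1)]→L[ℝ] ℝ)
    (hG : ∀ v a, G v a = wedgeOne (bilinOfTwoForm (D v) a) η) :
    alternatizeUncurryFin (alternatizeUncurryFinCLM ℝ V ℝ ∘L G) = 0 := by
  let T : V →L[ℝ] V →L[ℝ] V →L[ℝ] ℝ := bilinOfTwoForm ∘L D
  have hcyc : ∀ v a b, T v a b - T a v b + T b v a = 0 := fun v a b => by
    have h := congrArg (fun f => f ![v, a, b]) hD
    simp only [alternatizeUncurryFin_apply] at h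
    replace h := (Fin.sum_univ_three _).symm.trans h
    simp only [T, ContinuousLinearMap.comp_apply, bilinOfTwoForm_apply]
    have e0 : (0 : Fin 3).removeNth ![v, a, b] = ![a, b] := by
      ext i; fin_cases i <;> rfl
    have e1 : (1 : Fin 3).removeNth ![v, a, b] = ![v, b] := by
      ext i; fin_cases i <;> rfl
    have e2 : (2 : Fin 3).removeNth ![v, a, b] = ![v, a] := by
      ext i; fin_cases i <;> rfl
    rw [e0, e1, e2] at h
    simpa [sub_eq_add_neg] using h
  let S : (V →L[ℝ] ℝ) →L[ℝ] V →L[ℝ] V [⋀^Fin k]→L[ℝ] ℝ :=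
    (ContinuousLinearMap.smulRightL ℝ V (V [⋀^Fin k]→L[ℝ] ℝ)).flip η
  -- the threefold alternation of a trilinear map times `η`
  let A3 (F : V →L[ℝ] V →L[ℝ] V →L[ℝ] ℝ) : V [⋀^Fin (k + 3)]→L[ℝ] ℝ :=
    alternatizeUncurryFin (alternatizeUncurryFinCLM ℝ V ℝ ∘L
      (ContinuousLinearMap.compL ℝ V _ _ (wedgeOne.flip η) ∘L F))
  have hA3 : ∀ F, A3 F = alternatizeUncurryFin (alternatizeUncurryFinCLM ℝ V ℝ ∘L
      (ContinuousLinearMap.compL ℝ V _ _ (wedgeOne.flip η) ∘L F)) := fun _ => rfl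
  have hadd : ∀ F F' F'' : V →L[ℝ] V →L[ℝ] V →L[ℝ] ℝ, (∀ v a b, F'' v a b = F v a b + F' v a b) →
      A3 F'' = A3 F + A3 F' := fun F F' F'' h => by
    rw [hA3, hA3, hA3, ← alternatizeUncurryFin_add]
    congr 1
    ext1 v
    have e : F'' v = F v + F' v := by
      ext a b
      exact h v a b
    rw [_root_.add_apply, ContinuousLinearMap.comp_apply, ContinuousLinearMap.comp_apply, e, map_add,
      map_add]
    rfl
  have hsw1 : ∀ F, A3 F.flip = -A3 F := fun F => by
    rw [hA3, hA3, ← alternatize_swap]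
    rfl
  have hsw2 : ∀ F F' : V →L[ℝ] V →L[ℝ] V →L[ℝ] ℝ, (∀ v a b, F' v a b = F v b a) →
      A3 F' = -A3 F := fun F F' h => by
    rw [hA3, hA3, ← alternatizeUncurryFinCLM_apply, ← alternatizeUncurryFinCLM_apply, ← map_neg]
    congr 1
    ext1 v
    have e := alternatize_swap (S ∘L F v)
    have e' : (S ∘L F v).flip = S ∘L F' v := by
      ext1 a
      ext1 b
      change F v b a • η = F' v a b • η
      rw [h]
    rw [e'] at e
    exact e
  let T2 := T.flip
  let T3 : V →L[ℝ] V →L[ℝ] V →L[ℝ] ℝ := (ContinuousLinearMap.flipₗᵢ ℝ V V ℝ :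
    (V →L[ℝ] V →L[ℝ] ℝ) →L[ℝ] (V →L[ℝ] V →L[ℝ] ℝ)) ∘L T2
  have h3 : A3 T3 = -A3 T2 := hsw2 T2 T3 fun v a b => rfl
  have h2 : A3 T2 = -A3 T := hsw1 T
  have hGT : alternatizeUncurryFin (alternatizeUncurryFinCLM ℝ V ℝ ∘L G) = A3 T := by
    rw [hA3]
    congr 2
    ext1 v
    ext1 a
    rw [hG]
    rfl
  have h4 := hadd T T3 T2 fun v a b => by
    have := hcyc v a b
    change T a v b = T v a b + T b v a
    linarith
  rw [h3, h2, neg_neg] at h4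
  rw [hGT]
  have h5 : (3 : ℝ) • A3 T = 0 := by
    have : A3 T + A3 T + A3 T = 0 := by
      nth_rewrite 2 [← neg_neg (A3 T)]
      rw [h4]
      abel
    rw [← this]
    module
  simpa using h5


open ContinuousAlternatingMap in
theorem isBoundedBilinearMap_wedgeTwo : IsBoundedBilinearMap ℝ
    (fun p : (V [⋀^Fin 2]→L[ℝ] ℝ) × (V [⋀^Fin k]→L[ℝ] ℝ) => wedgeTwo p.1 p.2) where
  add_left ω₁ ω₂ η := by
    simp only [wedgeTwo, map_add, ContinuousLinearMap.comp_add, alternatizeUncurryFin_add, smul_add]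
  smul_left c ω₀ η := by
    simp only [wedgeTwo, map_smul, ContinuousLinearMap.comp_smul, alternatizeUncurryFin_smul]
    rw [smul_comm]
  add_right ω₀ η ζ := wedgeTwo_add ω₀ η ζ
  smul_right c ω₀ η := wedgeTwo_smul ω₀ c η
  bound := by
    refine ⟨(↑(k + 1) + 1) * (k + 1) + 1, by positivity, fun ω₀ η => ?_⟩
    have h1 : ∀ v, ‖bilinOfTwoForm ω₀ v‖ ≤ ‖ω₀‖ * ‖v‖ := fun v =>
      ContinuousLinearMap.opNorm_le_bound _ (by positivity) fun w => by
        rw [bilinOfTwoForm_apply]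
        refine (ω₀.le_opNorm _).trans_eq ?_
        rw [Fin.prod_univ_two, mul_assoc]
        rfl
    have h2 : ‖(wedgeOne.flip η ∘L bilinOfTwoForm ω₀ : V →L[ℝ] V [⋀^Fin (k + 1)]→L[ℝ] ℝ)‖ ≤
        (k + 1) * ‖ω₀‖ * ‖η‖ := by
      refine ContinuousLinearMap.opNorm_le_bound _ (by positivity) fun v => ?_
      change ‖alternatizeUncurryFin ((bilinOfTwoForm ω₀ v).smulRight η)‖ ≤ _
      refine (norm_alternatizeUncurryFin_le _).trans ?_
      rw [ContinuousLinearMap.norm_smulRight_apply]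
      calc ((k : ℝ) + 1) * (‖bilinOfTwoForm ω₀ v‖ * ‖η‖)
          ≤ ((k : ℝ) + 1) * ((‖ω₀‖ * ‖v‖) * ‖η‖) := by gcongr; exact h1 v
        _ = _ := by ring
    have h3 : ‖wedgeTwo ω₀ η‖ ≤ 1 * ((↑(k + 1) + 1) * ((k + 1) * ‖ω₀‖ * ‖η‖)) := by
      rw [wedgeTwo, norm_smul]
      gcongr
      · norm_num
      · exact (norm_alternatizeUncurryFin_le _).trans (by gcongr)
    have : 0 ≤ ‖ω₀‖ * ‖η‖ := by positivity
    change ‖wedgeTwo ω₀ η‖ ≤ _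
    nlinarith

open ContinuousAlternatingMap in
/-- The algebraic part of the Leibniz rule for `ω ∧ η` with `ω` closed. -/
theorem alternatize_leibniz (ω₀ : V [⋀^Fin 2]→L[ℝ] ℝ) (η : V [⋀^Fin k]→L[ℝ] ℝ)
    (D : V →L[ℝ] V [⋀^Fin 2]→L[ℝ] ℝ) (D' : V →L[ℝ] V [⋀^Fin k]→L[ℝ] ℝ)
    (hD : alternatizeUncurryFin D = 0) (F : V →L[ℝ] V [⋀^Fin (k + 2)]→L[ℝ] ℝ)
    (hF : ∀ v, F v = wedgeTwo ω₀ (D' v) + wedgeTwo (D v) η) :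
    alternatizeUncurryFin F = wedgeTwo ω₀ (alternatizeUncurryFin D') := by
  let G1 : V →L[ℝ] V →L[ℝ] V [⋀^Fin (k + 1)]→L[ℝ] ℝ :=
    (ContinuousLinearMap.compL ℝ V (V →L[ℝ] ℝ) (V [⋀^Fin (k + 1)]→L[ℝ] ℝ)).flip
      (bilinOfTwoForm ω₀) ∘L (wedgeOne.flip ∘L D')
  let G2 : V →L[ℝ] V →L[ℝ] V [⋀^Fin (k + 1)]→L[ℝ] ℝ :=
    ContinuousLinearMap.compL ℝ V (V →L[ℝ] ℝ) (V [⋀^Fin (k + 1)]→L[ℝ] ℝ)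
      (wedgeOne.flip η) ∘L (bilinOfTwoForm ∘L D)
  have e : F = (1 / 2 : ℝ) • (alternatizeUncurryFinCLM ℝ V ℝ ∘L G1) +
      (1 / 2 : ℝ) • (alternatizeUncurryFinCLM ℝ V ℝ ∘L G2) := by
    ext1 v
    rw [hF]
    rfl
  rw [e, alternatizeUncurryFin_add, alternatizeUncurryFin_smul, alternatizeUncurryFin_smul,
    alternatize_wedge_left D hD η G2 fun v a => rfl,
    alternatize_wedge_right (bilinOfTwoForm ω₀) D' G1 fun v a => rfl, smul_zero, add_zero]
  rfl

theorem extDerivWithin_wedgeTwo {s : Set V} {x : V} (hs : UniqueDiffWithinAt ℝ s x)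
    {f : V → V [⋀^Fin 2]→L[ℝ] ℝ} {g : V → V [⋀^Fin k]→L[ℝ] ℝ}
    (hf : DifferentiableWithinAt ℝ f s x) (hg : DifferentiableWithinAt ℝ g s x)
    (hd : extDerivWithin f s x = 0) :
    extDerivWithin (fun y => wedgeTwo (f y) (g y)) s x =
      wedgeTwo (f x) (extDerivWithin g s x) := by
  have h1 := (isBoundedBilinearMap_wedgeTwo (V := V) (k := k)).hasFDerivAt (f x, g x)
  have h2 := h1.comp_hasFDerivWithinAt x (hf.hasFDerivWithinAt.prodMk hg.hasFDerivWithinAt)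
  refine alternatize_leibniz (f x) (g x) (fderivWithin ℝ f s x) _ hd _ fun v => ?_
  have h3 : fderivWithin ℝ (fun y => wedgeTwo (f y) (g y)) s x = _ := h2.fderivWithin hs
  rw [h3]
  rfl

theorem contDiff_wedgeTwo  {m : WithTop ℕ∞} : ContDiff ℝ m
      (fun p : (V [⋀^Fin 2]→L[ℝ] ℝ) × (V [⋀^Fin k]→L[ℝ] ℝ) => wedgeTwo p.1 p.2) := isBoundedBilinearMap_wedgeTwo.contDiff

theorem contDiffWithinAt_wedgeTwo {U : Type*} [NormedAddCommGroup U] [NormedSpace ℝ U]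
    {s : Set U} {x : U} {m : WithTop ℕ∞} {f : U → V [⋀^Fin 2]→L[ℝ] ℝ}
    {g : U → V [⋀^Fin k]→L[ℝ] ℝ} (hf : ContDiffWithinAt ℝ m f s x)
    (hg : ContDiffWithinAt ℝ m g s x) :
    ContDiffWithinAt ℝ m (fun y => wedgeTwo (f y) (g y)) s x := by
  have h2 := hf.prodMk hg
  have h3 := contDiff_wedgeTwo.comp_contDiffWithinAt h2
  exact h3

end Linear

section Manifold

variable {E : Type*} [NormedAddCommGroup E] [NormedSpace ℝ E]
  {H : Type*} [TopologicalSpace H] (I : ModelWithCorners ℝ E H)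
  {M : Type*} [TopologicalSpace M] [ChartedSpace H M] [IsManifold I ∞ M] {k : ℕ}

/-- A section `η` of `Λᵏ T*M` is a function `M → E [⋀^Fin k]→L[ℝ] ℝ`, since Mathlib's tangent space
`TangentSpace I x` is the model space `E`, identified through the preferred chart at `x`.
`inChart I η x₀` is the coordinate expression of `η` in the preferred chart at `x₀`, i.e. its
pullback under the inverse of that chart. -/
def inChart (η : M → E [⋀^Fin k]→L[ℝ] ℝ) (x₀ : M) (y : E) : E [⋀^Fin k]→L[ℝ] ℝ :=
  (η ((extChartAt I x₀).symm y)).compContinuousLinearMap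
    (tangentCoordChange I x₀ ((extChartAt I x₀).symm y) ((extChartAt I x₀).symm y))

theorem inChart_self (η : M → E [⋀^Fin k]→L[ℝ] ℝ) (x : M) :
    inChart I η x (extChartAt I x x) = η x := by
  ext v
  rw [inChart, extChartAt_to_inv, ContinuousAlternatingMap.compContinuousLinearMap_apply]
  congr 1
  ext1 i
  exact tangentCoordChange_self (mem_extChartAt_source x)

variable (M k) in
/-- The smooth `k`-forms on `M` (up to the boundary), as a subspace of all sections. -/
def formSubmodule : Submodule ℝ (M → E [⋀^Fin k]→L[ℝ] ℝ) where
  carrier := {η | ∀ x₀ : M, ContDiffOn ℝ ∞ (inChart I η x₀) (extChartAt I x₀).target}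
  add_mem' hη hζ x₀ := (hη x₀).add (hζ x₀)
  zero_mem' _ := contDiffOn_const (c := (0 : E [⋀^Fin k]→L[ℝ] ℝ))
  smul_mem' c _ hη x₀ := (hη x₀).const_smul c

variable (M k) in
/-- The space `Ω^k(M)` of smooth `k`-forms on `M`. -/
def Form : Type _ := formSubmodule I M k

instance : AddCommGroup (Form I M k) := inferInstanceAs (AddCommGroup (formSubmodule I M k))

instance : Module ℝ (Form I M k) := inferInstanceAs (Module ℝ (formSubmodule I M k))

variable {I}

theorem form_contDiffWithinAt (η : Form I M k) {x₀ : M} {y : E} (hy : y ∈ (extChartAt I x₀).target) :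
    ContDiffWithinAt ℝ ∞ (inChart I η.1 x₀) (range I) y :=
  (η.2 x₀ y hy).mono_of_mem_nhdsWithin (extChartAt_target_mem_nhdsWithin_of_mem hy)

theorem form_differentiableWithinAt (η : Form I M k) {x₀ : M} {y : E}
    (hy : y ∈ (extChartAt I x₀).target) :
    DifferentiableWithinAt ℝ (inChart I η.1 x₀) (range I) y :=
  (form_contDiffWithinAt η hy).differentiableWithinAt (by simp)

/-- The exterior derivative does not depend on the chart in which it is computed. -/
theorem inChart_extDerivWithin (η : Form I M k) {x₀ : M} {y : E}
    (hy : y ∈ (extChartAt I x₀).target) :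
    inChart I (fun x => extDerivWithin (inChart I η.1 x) (range I) (extChartAt I x x)) x₀ y =
      extDerivWithin (inChart I η.1 x₀) (range I) y := by
  obtain ⟨z, hz⟩ : ∃ z, z = (extChartAt I x₀).symm y := ⟨_, rfl⟩
  have hz₀ : z ∈ (extChartAt I x₀).source := hz ▸ (extChartAt I x₀).map_target hy
  have hyz : extChartAt I x₀ z = y := by rw [hz, (extChartAt I x₀).right_inv hy]
  have hyr : y ∈ range I := extChartAt_target_subset_range x₀ hy
  -- the transition map
  obtain ⟨τ, hτ⟩ : ∃ τ : E → E, τ = extChartAt I z ∘ (extChartAt I x₀).symm := ⟨_, rfl⟩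
  have hτy : τ y = extChartAt I z z := by rw [hτ, Function.comp_apply, ← hz]
  have hcont : ∀ᶠ y' in 𝓝[range I] y, y' ∈ (extChartAt I x₀).target ∧
      (extChartAt I x₀).symm y' ∈ (extChartAt I z).source := by
    have h1 : ∀ᶠ y' in 𝓝[range I] y, y' ∈ (extChartAt I x₀).target :=
      extChartAt_target_mem_nhdsWithin_of_mem hy
    refine h1.and ?_
    have hc : ContinuousWithinAt (extChartAt I x₀).symm (range I) y :=
      ((continuousOn_extChartAt_symm x₀) y hy).mono_of_mem_nhdsWithin
        (extChartAt_target_mem_nhdsWithin_of_mem hy)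
    refine hc.eventually_mem ((isOpen_extChartAt_source z).mem_nhds ?_)
    rw [← hz]
    exact mem_extChartAt_source z
  have hev : inChart I η.1 x₀ =ᶠ[𝓝[range I] y] fun y' =>
      (inChart I η.1 z (τ y')).compContinuousLinearMap (fderivWithin ℝ τ (range I) y') := by
    filter_upwards [hcont] with y' hy'
    obtain ⟨z', hz'⟩ : ∃ z', z' = (extChartAt I x₀).symm y' := ⟨_, rfl⟩
    rw [← hz'] at hy'
    have hz'₀ : z' ∈ (extChartAt I x₀).source := hz' ▸ (extChartAt I x₀).map_target hy'.1
    have e1 : (extChartAt I z).symm (τ y') = z' := by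
      rw [hτ, Function.comp_apply, ← hz', (extChartAt I z).left_inv hy'.2]
    have e2 : fderivWithin ℝ τ (range I) y' = tangentCoordChange I x₀ z z' := by
      rw [tangentCoordChange_def, hτ, hz', (extChartAt I x₀).right_inv hy'.1]
    ext v
    rw [inChart, inChart, e1, e2, ← hz']
    simp only [ContinuousAlternatingMap.compContinuousLinearMap_apply]
    congr 1
    ext1 i
    exact (tangentCoordChange_comp ⟨⟨hz'₀, hy'.2⟩, mem_extChartAt_source z'⟩).symm
  have hτd : ContDiffWithinAt ℝ ∞ τ (range I) y := by
    rw [hτ]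
    refine contDiffWithinAt_ext_coord_change z x₀ ?_
    rw [PartialEquiv.trans_source, PartialEquiv.symm_source]
    exact ⟨hy, by rw [mem_preimage, ← hz]; exact mem_extChartAt_source z⟩
  have hyt : extChartAt I z z ∈ (extChartAt I z).target := mem_extChartAt_target z
  have hd : DifferentiableWithinAt ℝ (inChart I η.1 z) (range I) (τ y) :=
    hτy ▸ form_differentiableWithinAt η hyt
  have hmaps : MapsTo τ (range I) (range I) := by
    intro y' _
    rw [hτ]
    exact mem_range_self _
  have hpb := extDerivWithin_pullback hd hτd (r := ∞)
    (by rw [minSmoothness_of_isRCLikeNormedField]; exact WithTop.coe_le_coe.2 (le_top : (2 : ℕ∞) ≤ ⊤)) I.uniqueDiffOn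
    (I.range_subset_closure_interior hyr) hyr hmaps
  rw [hev.extDerivWithin_eq_of_mem hyr, hpb, inChart, ← hz, hτy]
  congr 1
  rw [tangentCoordChange_def, hτ, hyz]

/-- The exterior derivative `d : Ω^k(M) → Ω^{k+1}(M)`, at each point `x` computed in the chart at `x`. -/
def d : Form I M k →ₗ[ℝ] Form I M (k + 1) where
  toFun η := ⟨fun x => extDerivWithin (inChart I η.1 x) (range I) (extChartAt I x x), fun x₀ => by
    refine ContDiffOn.congr (fun y hy => ?_) fun y hy => inChart_extDerivWithin η hy
    have hyr : y ∈ range I := extChartAt_target_subset_range x₀ hy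
    have h : ContDiffWithinAt ℝ ∞ (fderivWithin ℝ (inChart I η.1 x₀) (range I)) (range I) y :=
      (form_contDiffWithinAt η hy).fderivWithin_right I.uniqueDiffOn (by simp) hyr
    exact ((ContinuousAlternatingMap.alternatizeUncurryFinCLM ℝ E ℝ).contDiff.comp_contDiffWithinAt
      h).mono (extChartAt_target_subset_range x₀)⟩
  map_add' η ζ := Subtype.ext <| funext fun x =>
    extDerivWithin_add (I.uniqueDiffOn _ (mem_range_self _))
      (form_differentiableWithinAt η (mem_extChartAt_target x))
      (form_differentiableWithinAt ζ (mem_extChartAt_target x))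
  map_smul' c η := Subtype.ext <| funext fun x =>
    extDerivWithin_smul c (inChart I η.1 x)
      (I.uniqueDiffOn _ (extChartAt_target_subset_range x (mem_extChartAt_target x)))

theorem inChart_d (η : Form I M k) {x₀ : M} {y : E} (hy : y ∈ (extChartAt I x₀).target) :
    inChart I (d η).1 x₀ y = extDerivWithin (inChart I η.1 x₀) (range I) y :=
  inChart_extDerivWithin η hy

/-- The product `f η` of a smooth function and a form. -/
def mulForm (f : C^∞⟮I, M; ℝ⟯) : Form I M k →ₗ[ℝ] Form I M k where
  toFun η := ⟨fun x => f x • η.1 x, fun x₀ => by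
    have hf : ContDiffOn ℝ ∞ (fun y => f ((extChartAt I x₀).symm y)) (extChartAt I x₀).target :=
      (f.contMDiff.comp_contMDiffOn (contMDiffOn_extChartAt_symm x₀)).contDiffOn
    exact hf.smul (η.2 x₀)⟩
  map_add' η ζ := Subtype.ext <| funext fun x => smul_add _ _ _
  map_smul' c η := Subtype.ext <| funext fun x => smul_comm (f x) c (η.1 x)

theorem inChart_wedgeTwo (ω₀ : Form I M 2) (η : Form I M k) (x₀ : M) (y : E) :
    inChart I (fun x => wedgeTwo (ω₀.1 x) (η.1 x)) x₀ y =
      wedgeTwo (inChart I ω₀.1 x₀ y) (inChart I η.1 x₀ y) :=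
  (wedgeTwo_compContinuousLinearMap _ _ _).symm

/-- The wedge product `η ↦ ω ∧ η` with a smooth `2`-form; for a symplectic form this is the Lefschetz
operator `L`. -/
def wedge (ω₀ : Form I M 2) : Form I M k →ₗ[ℝ] Form I M (k + 2) where
  toFun η := ⟨fun x => wedgeTwo (ω₀.1 x) (η.1 x), fun x₀ => by
    refine ContDiffOn.congr (fun y hy => ?_) fun y _ => inChart_wedgeTwo ω₀ η x₀ y
    exact contDiffWithinAt_wedgeTwo (ω₀.2 x₀ y hy) (η.2 x₀ y hy)⟩
  map_add' η ζ := Subtype.ext <| funext fun x => wedgeTwo_add _ _ _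
  map_smul' c η := Subtype.ext <| funext fun x => wedgeTwo_smul _ _ _

/-- `d (ω ∧ η) = ω ∧ dη` for a closed `2`-form `ω`. -/
theorem d_wedge (ω₀ : Form I M 2) (hω₀ : d ω₀ = 0) (η : Form I M k) :
    d (wedge ω₀ η) = wedge ω₀ (d η) := by
  refine Subtype.ext <| funext fun x => ?_
  have hx := mem_extChartAt_target (I := I) x
  have h0 : extDerivWithin (inChart I ω₀.1 x) (range I) (extChartAt I x x) = 0 :=
    congrFun (congrArg Subtype.val hω₀) x
  have h1 : inChart I (wedge ω₀ η).1 x =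
      fun y => wedgeTwo (inChart I ω₀.1 x y) (inChart I η.1 x y) :=
    funext fun y => inChart_wedgeTwo ω₀ η x y
  change extDerivWithin (inChart I (wedge ω₀ η).1 x) (range I) (extChartAt I x x) = _
  rw [h1, extDerivWithin_wedgeTwo (I.uniqueDiffOn _ (extChartAt_target_subset_range x hx))
    (form_differentiableWithinAt ω₀ hx) (form_differentiableWithinAt η hx) h0, inChart_self]
  rfl

theorem mulForm_wedge (ω₀ : Form I M 2) (f : C^∞⟮I, M; ℝ⟯) (η : Form I M k) :
    mulForm f (wedge ω₀ η) = wedge ω₀ (mulForm f η) :=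
  Subtype.ext <| funext fun x => (wedgeTwo_smul (ω₀.1 x) (f x) (η.1 x)).symm

/-! ### Boundary conditions and cohomology -/

variable (I M) in
/-- A symplectic form on `M`: a smooth closed nondegenerate `2`-form. -/
structure SymplecticForm where
  /-- the underlying smooth `2`-form -/
  form : Form I M 2
  closed : d form = 0
  nondegenerate : ∀ (x : M) (v : E), (∀ w : E, form.1 x ![v, w] = 0) → v = 0

variable (I M) in
/-- A boundary defining function: a smooth function on `M` (up to the boundary) that is negative in
the interior, vanishes on the boundary, and has nonvanishing differential along the boundary. -/
structure BoundaryDefiningFunction where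
  /-- the underlying smooth function -/
  fn : C^∞⟮I, M; ℝ⟯
  neg_of_interior : ∀ x ∈ I.interior M, fn x < 0
  eq_zero_of_boundary : ∀ x ∈ I.boundary M, fn x = 0
  mfderiv_ne_zero : ∀ x ∈ I.boundary M, mfderiv I 𝓘(ℝ, ℝ) fn x ≠ 0

/-- The space `Ω^k_D` of smooth `k`-forms with the Dirichlet boundary condition
`d(ρη)|_{∂M} = 0`. -/
def dirichlet (ρ : BoundaryDefiningFunction I M) (k : ℕ) : Submodule ℝ (Form I M k) where
  carrier := {η | ∀ x ∈ I.boundary M, (d (mulForm ρ.fn η)).1 x = 0}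
  add_mem' {η ζ} hη hζ x hx := by
    rw [map_add, map_add]
    change (d (mulForm ρ.fn η)).1 x + (d (mulForm ρ.fn ζ)).1 x = 0
    rw [hη x hx, hζ x hx, add_zero]
  zero_mem' x _ := by
    rw [map_zero, map_zero]
    rfl
  smul_mem' c η hη x hx := by
    rw [map_smul, map_smul]
    change c • (d (mulForm ρ.fn η)).1 x = 0
    rw [hη x hx, smul_zero]

/-- Closed `k`-forms satisfying the Dirichlet condition. -/
def relCocycles (ρ : BoundaryDefiningFunction I M) (k : ℕ) : Submodule ℝ (Form I M k) :=
  LinearMap.ker d ⊓ dirichlet ρ k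

/-- The forms `dφ` with `φ ∈ Ω^{k-1}_D`; zero for `k = 0`. -/
def relCoboundaries (ρ : BoundaryDefiningFunction I M) : (k : ℕ) → Submodule ℝ (Form I M k)
  | 0 => ⊥
  | k + 1 => (dirichlet ρ k).map d

/-- The relative de Rham cohomology `H^k(d, D)`. -/
abbrev RelDeRham (ρ : BoundaryDefiningFunction I M) (k : ℕ) : Type _ :=
  relCocycles ρ k ⧸ (relCoboundaries ρ k).submoduleOf (relCocycles ρ k)

theorem wedge_mem_dirichlet (ω₀ : SymplecticForm I M) (ρ : BoundaryDefiningFunction I M)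
    {η : Form I M k} (hη : η ∈ dirichlet ρ k) : wedge ω₀.form η ∈ dirichlet ρ (k + 2) := by
  intro x hx
  rw [mulForm_wedge, d_wedge _ ω₀.closed]
  change wedgeTwo (ω₀.form.1 x) ((d (mulForm ρ.fn η)).1 x) = 0
  rw [hη x hx, ← zero_smul ℝ (0 : E [⋀^Fin (k + 1)]→L[ℝ] ℝ), wedgeTwo_smul, zero_smul]

theorem wedge_mem_relCocycles (ω₀ : SymplecticForm I M) (ρ : BoundaryDefiningFunction I M)
    {η : Form I M k} (hη : η ∈ relCocycles ρ k) : wedge ω₀.form η ∈ relCocycles ρ (k + 2) :=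
  ⟨LinearMap.mem_ker.2 (by rw [d_wedge _ ω₀.closed, LinearMap.mem_ker.1 hη.1, map_zero]),
    wedge_mem_dirichlet ω₀ ρ hη.2⟩

theorem wedge_mem_relCoboundaries (ω₀ : SymplecticForm I M) (ρ : BoundaryDefiningFunction I M)
    {η : Form I M k} (hη : η ∈ relCoboundaries ρ k) :
    wedge ω₀.form η ∈ relCoboundaries ρ (k + 2) := by
  cases k with
  | zero =>
    rw [(Submodule.mem_bot ℝ).1 hη, map_zero]
    exact Submodule.zero_mem _
  | succ k =>
    obtain ⟨φ, hφ, rfl⟩ := hη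
    exact ⟨wedge ω₀.form φ, wedge_mem_dirichlet ω₀ ρ hφ, d_wedge _ ω₀.closed φ⟩

/-- The Lefschetz map `L : H^k(d, D) → H^{k+2}(d, D)`, `[η] ↦ [ω ∧ η]`. -/
def lefschetzMap (ω₀ : SymplecticForm I M) (ρ : BoundaryDefiningFunction I M) (k : ℕ) :
    RelDeRham ρ k →ₗ[ℝ] RelDeRham ρ (k + 2) :=
  Submodule.mapQ _ _
    ((wedge ω₀.form).restrict fun _ hη => wedge_mem_relCocycles ω₀ ρ hη)
    fun _ hη => wedge_mem_relCoboundaries ω₀ ρ hη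

/-- `ker[L : H^{k-1}(d, D) → H^{k+1}(d, D)]`; for `k = 0` this is zero, as `H^{-1}(d, D) = 0`. -/
def lefschetzKer (ω₀ : SymplecticForm I M) (ρ : BoundaryDefiningFunction I M) :
    (k : ℕ) → Submodule ℝ (RelDeRham ρ (k - 1))
  | 0 => ⊥
  | k + 1 => LinearMap.ker (lefschetzMap ω₀ ρ k)

/-- The image of `L : H^{k-2}(d, D) → H^k(d, D)`; for `k = 0, 1` it is zero, as
`H^{-2}(d, D) = H^{-1}(d, D) = 0`. -/
def lefschetzRange (ω₀ : SymplecticForm I M) (ρ : BoundaryDefiningFunction I M) :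
    (k : ℕ) → Submodule ℝ (RelDeRham ρ k)
  | 0 => ⊥
  | 1 => ⊥
  | k + 2 => LinearMap.range (lefschetzMap ω₀ ρ k)

/-- `coker[L : H^{k-2}(d, D) → H^k(d, D)]`. -/
abbrev LefschetzCoker (ω₀ : SymplecticForm I M) (ρ : BoundaryDefiningFunction I M) (k : ℕ) :
    Type _ :=
  RelDeRham ρ k ⧸ lefschetzRange ω₀ ρ k

section Primitive

variable [FiniteDimensional ℝ E]

/-- The space `P^k` of primitive `k`-forms: smooth `k`-forms `η` with `Λη = 0`. As `Λ` lowers the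
degree by two, every form of degree `0` or `1` is primitive. -/
def primitive (ω₀ : SymplecticForm I M) : (k : ℕ) → Submodule ℝ (Form I M k)
  | 0 => ⊤
  | 1 => ⊤
  | k + 2 =>
    { carrier := {η | ∀ x, lefschetzDual (Module.finBasis ℝ E) (ω₀.form.1 x) (η.1 x) = 0}
      add_mem' := fun {η ζ} hη hζ x => by
        change lefschetzDual (Module.finBasis ℝ E) (ω₀.form.1 x) (η.1 x + ζ.1 x) = 0
        rw [map_add, hη x, hζ x, add_zero]
      zero_mem' := fun x => map_zero _
      smul_mem' := fun c η hη x => by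
        change lefschetzDual (Module.finBasis ℝ E) (ω₀.form.1 x) (c • η.1 x) = 0
        rw [map_smul, hη x, smul_zero] }

/-- The primitive `(k-1)`-forms multiplied by the symplectic form, i.e. the subspace
`{ω ∧ ξ | ξ ∈ P^{k-1}}` of `Ω^{k+1}`; it is zero for `k = 0`. -/
def wedgePrimitive (ω₀ : SymplecticForm I M) : (k : ℕ) → Submodule ℝ (Form I M (k + 1))
  | 0 => ⊥
  | k + 1 => (primitive ω₀ k).map (wedge ω₀.form)

/-- The operator `∂₊` on primitive `k`-forms, given by its graph: `∂₊η = ζ` means that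
`η ∈ P^k`, `ζ ∈ P^{k+1}` and `dη = ζ + ω ∧ ξ` for some `ξ ∈ P^{k-1}`. For `2k + 2 ≤ dim M` the
uniqueness in the Lefschetz decomposition makes `ζ` a function of `η`. -/
def delPlus (ω₀ : SymplecticForm I M) (k : ℕ) :
    Submodule ℝ (Form I M k × Form I M (k + 1)) where
  carrier := {p | p.1 ∈ primitive ω₀ k ∧ p.2 ∈ primitive ω₀ (k + 1) ∧
    d p.1 - p.2 ∈ wedgePrimitive ω₀ k}
  add_mem' := by
    rintro ⟨η, ζ⟩ ⟨η', ζ'⟩ ⟨h1, h2, h3⟩ ⟨h1', h2', h3'⟩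
    refine ⟨add_mem h1 h1', add_mem h2 h2', ?_⟩
    have h := add_mem h3 h3'
    rw [sub_add_sub_comm, ← map_add] at h
    exact h
  zero_mem' := ⟨zero_mem _, zero_mem _, by simp⟩
  smul_mem' := by
    rintro c ⟨η, ζ⟩ ⟨h1, h2, h3⟩
    refine ⟨Submodule.smul_mem _ c h1, Submodule.smul_mem _ c h2, ?_⟩
    have h := Submodule.smul_mem _ c h3
    rw [smul_sub, ← map_smul] at h
    exact h

/-- The space `P^k_{D₊}` of primitive `k`-forms `η` with the `∂₊`-Dirichlet boundary condition
`∂₊(ρη)|_{∂M} = 0`. -/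
def primitiveDPlus (ω₀ : SymplecticForm I M) (ρ : BoundaryDefiningFunction I M) (k : ℕ) :
    Submodule ℝ (Form I M k) where
  carrier := {η | η ∈ primitive ω₀ k ∧ ∃ ζ : Form I M (k + 1),
    (mulForm ρ.fn η, ζ) ∈ delPlus ω₀ k ∧ ∀ x ∈ I.boundary M, ζ.1 x = 0}
  add_mem' := by
    rintro η η' ⟨h, ζ, h1, h2⟩ ⟨h', ζ', h1', h2'⟩
    refine ⟨add_mem h h', ζ + ζ', ?_, fun x hx => ?_⟩
    · rw [map_add]
      exact add_mem h1 h1'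
    · change ζ.1 x + ζ'.1 x = 0
      rw [h2 x hx, h2' x hx, add_zero]
  zero_mem' := ⟨zero_mem _, 0, by rw [map_zero]; exact zero_mem _, fun _ _ => rfl⟩
  smul_mem' := by
    rintro c η ⟨h, ζ, h1, h2⟩
    refine ⟨Submodule.smul_mem _ c h, c • ζ, ?_, fun x hx => ?_⟩
    · rw [map_smul]
      exact Submodule.smul_mem _ c h1
    · change c • ζ.1 x = 0
      rw [h2 x hx, smul_zero]

/-- `{η ∈ P^k_{D₊} | ∂₊η = 0}`. -/
def primCocycles (ω₀ : SymplecticForm I M) (ρ : BoundaryDefiningFunction I M) (k : ℕ) :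
    Submodule ℝ (Form I M k) :=
  primitiveDPlus ω₀ ρ k ⊓ (delPlus ω₀ k).comap (LinearMap.inl ℝ _ _)

/-- `{∂₊φ | φ ∈ P^{k-1}_{D₊}}`; zero for `k = 0`. -/
def primCoboundaries (ω₀ : SymplecticForm I M) (ρ : BoundaryDefiningFunction I M) :
    (k : ℕ) → Submodule ℝ (Form I M k)
  | 0 => ⊥
  | k + 1 =>
    (delPlus ω₀ k ⊓ (primitiveDPlus ω₀ ρ k).comap (LinearMap.fst ℝ _ _)).map (LinearMap.snd ℝ _ _)

/-- The relative primitive cohomology `PH^k(∂₊, D₊)`, for `2k < dim M`. -/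
abbrev RelPrimitive (ω₀ : SymplecticForm I M) (ρ : BoundaryDefiningFunction I M) (k : ℕ) :
    Type _ :=
  primCocycles ω₀ ρ k ⧸ (primCoboundaries ω₀ ρ k).submoduleOf (primCocycles ω₀ ρ k)

end Primitive

end Manifold

end SymplecticForms

end

/-! The relation [Λ, L] = n - k in degree k makes L injective on Ω^k for k < n and gives Ω^k = P^k ⊕
LΩ^{k-2} for k ≤ n (`LefschetzAction`, `isCompl_primitive`). So P^k is a copy of Ω^k / LΩ^{k-2}, and
∂₊ should be the operator that d induces on these quotients. The definition of ∂₊ also asks that ξ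
in dη = ζ + ω ∧ ξ be primitive. This is automatic, because Λ²dη = 0 for primitive η (`dual_dual_d`,
`mem_delPlus_iff`), which in turn follows from [Λ, [Λ, d]] = 0.

The boundary conditions match as well. Along ∂M one has d(ρη) = dρ ∧ η, so Ω_D consists of the forms
with dρ ∧ η = 0 there, and a primitive η lies in P_{D₊} exactly when η + l is in Ω_D for some l in
the image of L (`exists_add_mem_dirichlet`, `mem_primitiveDPlus`). This rests on smooth division by
dρ along the boundary (`exists_wedgeOne_eq`), which also shows that d preserves Ω_D
(`d_mem_dirichlet`).

Hence PH^k = Z / (dΩ_D^{k-1} + LΩ_D^{k-2}), where Z is the set of α in Ω_D^k with dα in the image of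
L. Writing dα = ω ∧ ξ and sending α to [ξ] maps Z onto ker L in H^{k-1}(d, D). The kernel of this
map consists of the closed Dirichlet forms plus LΩ_D^{k-2}, and modulo the denominator it is coker
L. The resulting short exact sequence 0 → coker L → PH^k → ker L → 0 splits over ℝ
(`nonempty_equiv_prod`). It is a piece of the long exact sequence of Ω_D → Ω_D → Ω_D / LΩ_D, made
explicit. -/

namespace SymplecticForms

/-! ### Exterior algebra at a point: contractions, and the commutators of Λ with wedge products. -/

section PointwiseAlgebra

open ContinuousAlternatingMap (alternatizeUncurryFin alternatizeUncurryFinCLM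
  alternatizeUncurryFin_apply curryLeft_apply_apply curryLeft_smul alternatizeUncurryFinCLM_apply
  alternatizeUncurryFin_alternatizeUncurryFinCLM_comp_of_symmetric)

variable {V : Type*} [NormedAddCommGroup V] [NormedSpace ℝ V] {k : ℕ}

/-- In the alternating sum, `v` is fed either to `F` itself, which gives `F v`, or to the first slot
of the form, where removing a later index costs one extra sign. -/
theorem curryLeft_alternatizeUncurryFin (F : V →L[ℝ] V [⋀^Fin (k + 1)]→L[ℝ] ℝ)
    (G' : V →L[ℝ] V [⋀^Fin k]→L[ℝ] ℝ) (v : V) (h : ∀ w, G' w = (F w).curryLeft v) :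
    (alternatizeUncurryFin F).curryLeft v = F v - alternatizeUncurryFin G' := by
  ext u
  rw [curryLeft_apply_apply, alternatizeUncurryFin_apply, Fin.sum_univ_succ,
    ContinuousAlternatingMap.sub_apply, alternatizeUncurryFin_apply, sub_eq_add_neg,
    ← Finset.sum_neg_distrib]
  congr 1
  · simp
  · refine Finset.sum_congr rfl fun i _ => ?_
    rw [h, curryLeft_apply_apply, Fin.val_succ, pow_succ]
    have : i.succ.removeNth (Matrix.vecCons v u) = Matrix.vecCons v (i.removeNth u) := by
      ext j
      cases j using Fin.cases <;> simp [Fin.removeNth]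
    rw [this]
    simp

theorem wedgeOne_fin_zero (α : V →L[ℝ] ℝ) (η : V [⋀^Fin 0]→L[ℝ] ℝ) (v : V) :
    (wedgeOne α η).curryLeft v = α v • η := by
  ext u
  rw [curryLeft_apply_apply, wedgeOne_apply]
  simp [Subsingleton.elim _ u]

theorem curryLeft_wedgeOne (α : V →L[ℝ] ℝ) (η : V [⋀^Fin (k + 1)]→L[ℝ] ℝ) (v : V) :
    (wedgeOne α η).curryLeft v = α v • η - wedgeOne α (η.curryLeft v) := by
  rw [wedgeOne_def, wedgeOne_def,
    curryLeft_alternatizeUncurryFin _ (α.smulRight (η.curryLeft v)) v fun w => ?_]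
  · rfl
  · ext u
    simp

/-- The vector can land in either slot of ω, and the two equal contributions cancel the 1/2 in
`wedgeTwo`. The terms where it lands in η are left abstract as `ζ`, so that degree 0, which has no
such terms, is covered too. -/
theorem curryLeft_wedgeTwo_aux (ω₀ : V [⋀^Fin 2]→L[ℝ] ℝ) (η : V [⋀^Fin k]→L[ℝ] ℝ) (v : V)
    (ζ : V →L[ℝ] V [⋀^Fin k]→L[ℝ] ℝ)
    (h : ∀ w, (wedgeOne (bilinOfTwoForm ω₀ w) η).curryLeft v =
      bilinOfTwoForm ω₀ w v • η - ζ w) :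
    (wedgeTwo ω₀ η).curryLeft v =
      wedgeOne (bilinOfTwoForm ω₀ v) η + (1 / 2 : ℝ) • alternatizeUncurryFin ζ := by
  have e : ∀ w, ((-bilinOfTwoForm ω₀ v).smulRight η - ζ) w =
      ((wedgeOne.flip η ∘L bilinOfTwoForm ω₀ : V →L[ℝ] V [⋀^Fin (k + 1)]→L[ℝ] ℝ) w).curryLeft v :=
    fun w => by
      change (-bilinOfTwoForm ω₀ v w) • η - ζ w = (wedgeOne (bilinOfTwoForm ω₀ w) η).curryLeft v
      rw [h, bilinOfTwoForm_swap ω₀ w v]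
  rw [wedgeTwo, curryLeft_smul, smul_apply, curryLeft_alternatizeUncurryFin _ _ v e]
  change (1 / 2 : ℝ) • (wedgeOne (bilinOfTwoForm ω₀ v) η - alternatizeUncurryFinCLM ℝ V ℝ _) = _
  rw [map_sub, alternatizeUncurryFinCLM_apply, alternatizeUncurryFinCLM_apply, ← wedgeOne_def,
    map_neg]
  change (1 / 2 : ℝ) • (wedgeOne (bilinOfTwoForm ω₀ v) η -
    (-wedgeOne (bilinOfTwoForm ω₀ v) η - alternatizeUncurryFin ζ)) = _
  module

theorem curryLeft_wedgeTwo_fin_zero (ω₀ : V [⋀^Fin 2]→L[ℝ] ℝ) (η : V [⋀^Fin 0]→L[ℝ] ℝ) (v : V) :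
    ContinuousAlternatingMap.curryLeft (n := 0 + 1) (wedgeTwo ω₀ η) v =
      wedgeOne (bilinOfTwoForm ω₀ v) η := by
  rw [curryLeft_wedgeTwo_aux ω₀ η v 0 fun w => ?_]
  · rw [← alternatizeUncurryFinCLM_apply, map_zero, smul_zero, add_zero]
  · rw [wedgeOne_fin_zero]
    simp

theorem curryLeft_wedgeTwo (ω₀ : V [⋀^Fin 2]→L[ℝ] ℝ) (η : V [⋀^Fin (k + 1)]→L[ℝ] ℝ) (v : V) :
    (wedgeTwo ω₀ η).curryLeft v =
      wedgeOne (bilinOfTwoForm ω₀ v) η + wedgeTwo ω₀ (η.curryLeft v) :=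
  curryLeft_wedgeTwo_aux ω₀ η v (wedgeOne.flip (η.curryLeft v) ∘L bilinOfTwoForm ω₀) fun w => by
    rw [curryLeft_wedgeOne]
    rfl

theorem curryLeft_add' (η ζ : V [⋀^Fin (k + 1)]→L[ℝ] ℝ) (v : V) :
    (η + ζ).curryLeft v = η.curryLeft v + ζ.curryLeft v := rfl

theorem curryLeft_sub' (η ζ : V [⋀^Fin (k + 1)]→L[ℝ] ℝ) (v : V) :
    (η - ζ).curryLeft v = η.curryLeft v - ζ.curryLeft v := by
  rw [eq_sub_iff_add_eq, ← curryLeft_add', sub_add_cancel]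

theorem curryLeft_smul' (c : ℝ) (η : V [⋀^Fin (k + 1)]→L[ℝ] ℝ) (v : V) :
    (c • η).curryLeft v = c • η.curryLeft v := rfl

theorem wedgeOne_self_wedgeOne (α : V →L[ℝ] ℝ) (η : V [⋀^Fin k]→L[ℝ] ℝ) :
    wedgeOne α (wedgeOne α η) = 0 := by
  let G : V →L[ℝ] V →L[ℝ] V [⋀^Fin k]→L[ℝ] ℝ := α.smulRight (α.smulRight η)
  have : alternatizeUncurryFin (alternatizeUncurryFinCLM ℝ V ℝ ∘L G) = 0 :=
    alternatizeUncurryFin_alternatizeUncurryFinCLM_comp_of_symmetric fun x y => by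
      exact smul_comm (α x) (α y) η
  rw [← this, wedgeOne_def]
  congr 1
  ext1 v
  change α v • wedgeOne α η = alternatizeUncurryFinCLM ℝ V ℝ (α v • α.smulRight η)
  rw [map_smul]
  rfl

/-- The algebraic Leibniz rule, applied with "derivative" 0 for ω and "derivative" α ⊗ η for η. -/
theorem wedgeOne_wedgeTwo (α : V →L[ℝ] ℝ) (ω₀ : V [⋀^Fin 2]→L[ℝ] ℝ) (η : V [⋀^Fin k]→L[ℝ] ℝ) :
    wedgeOne α (wedgeTwo ω₀ η) = wedgeTwo ω₀ (wedgeOne α η) := by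
  have h0 : alternatizeUncurryFin (0 : V →L[ℝ] V [⋀^Fin 2]→L[ℝ] ℝ) = 0 := by
    rw [← alternatizeUncurryFinCLM_apply, map_zero]
  rw [wedgeOne_def, wedgeOne_def]
  refine alternatize_leibniz ω₀ η 0 _ h0 _ fun v => ?_
  have h1 : wedgeTwo ((0 : V →L[ℝ] V [⋀^Fin 2]→L[ℝ] ℝ) v) η = 0 := by
    change wedgeTwo 0 η = 0
    have := (isBoundedBilinearMap_wedgeTwo (V := V) (k := k)).smul_left 0 0 η
    simpa using this
  rw [h1, add_zero]
  exact (wedgeTwo_smul _ _ _).symm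

section Basis

variable {ι : Type*} [Fintype ι] [DecidableEq ι] (b : Module.Basis ι ℝ V)

/-- The matrix of a `2`-form in a basis. -/
noncomputable def twoFormMatrix (ω₀ : V [⋀^Fin 2]→L[ℝ] ℝ) : Matrix ι ι ℝ := Matrix.of fun i j => ω₀ ![b i, b j]

omit [Fintype ι] [DecidableEq ι] in
theorem twoFormMatrix_apply (ω₀ : V [⋀^Fin 2]→L[ℝ] ℝ) (i j : ι) :
    twoFormMatrix b ω₀ i j = bilinOfTwoForm ω₀ (b i) (b j) :=
  (bilinOfTwoForm_apply _ _ _).symm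

omit [Fintype ι] [DecidableEq ι] in
theorem twoFormMatrix_transpose (ω₀ : V [⋀^Fin 2]→L[ℝ] ℝ) :
    (twoFormMatrix b ω₀).transpose = -twoFormMatrix b ω₀ := by
  ext i j
  rw [Matrix.transpose_apply, Matrix.neg_apply, twoFormMatrix_apply, twoFormMatrix_apply,
    bilinOfTwoForm_swap]

/-- The entries `(ω⁻¹)ⁱʲ` of the inverse matrix of a `2`-form. -/
noncomputable def poissonEntry (ω₀ : V [⋀^Fin 2]→L[ℝ] ℝ) (i j : ι) : ℝ := (twoFormMatrix b ω₀)⁻¹ i j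

theorem poissonEntry_swap (ω₀ : V [⋀^Fin 2]→L[ℝ] ℝ) (hω : IsUnit (twoFormMatrix b ω₀).det)
    (i j : ι) : poissonEntry b ω₀ j i = -poissonEntry b ω₀ i j := by
  have h : ((twoFormMatrix b ω₀)⁻¹).transpose = -(twoFormMatrix b ω₀)⁻¹ := by
    rw [Matrix.transpose_nonsing_inv, twoFormMatrix_transpose]
    refine Matrix.inv_eq_left_inv ?_
    rw [neg_mul_neg, Matrix.nonsing_inv_mul _ hω]
  exact congrFun (congrFun h i) j

theorem sum_poissonEntry_mul (ω₀ : V [⋀^Fin 2]→L[ℝ] ℝ) (hω : IsUnit (twoFormMatrix b ω₀).det)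
    (i l : ι) : ∑ j, poissonEntry b ω₀ i j * bilinOfTwoForm ω₀ (b j) (b l) =
      (1 : Matrix ι ι ℝ) i l := by
  rw [← Matrix.nonsing_inv_mul _ hω, Matrix.mul_apply]
  simp only [twoFormMatrix_apply, poissonEntry]

theorem isUnit_det_twoFormMatrix (ω₀ : V [⋀^Fin 2]→L[ℝ] ℝ)
    (hω : ∀ v, (∀ w, ω₀ ![v, w] = 0) → v = 0) : IsUnit (twoFormMatrix b ω₀).det := by
  rw [isUnit_iff_ne_zero]
  intro h
  obtain ⟨c, hc, hc'⟩ := Matrix.exists_vecMul_eq_zero_iff.2 h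
  refine hc ?_
  have h1 : bilinOfTwoForm ω₀ (∑ i, c i • b i) = 0 := by
    refine ContinuousLinearMap.coe_injective (b.ext fun j => ?_)
    have := congrFun hc' j
    simp only [Matrix.vecMul, dotProduct, twoFormMatrix_apply, Pi.zero_apply] at this
    simpa using this
  have h2 := hω (∑ i, c i • b i) fun w => by
    rw [← bilinOfTwoForm_apply, h1]
    rfl
  exact funext fun i => Fintype.linearIndependent_iff.1 b.linearIndependent c h2 i

/-- The vector `∑ᵢⱼ (ω⁻¹)ⁱʲ α(bⱼ) bᵢ` dual to a covector `α`. -/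
noncomputable def sharp (ω₀ : V [⋀^Fin 2]→L[ℝ] ℝ) (α : V →L[ℝ] ℝ) : V :=
  ∑ i, ∑ j, (poissonEntry b ω₀ i j * α (b j)) • b i

/-- The inverse matrix times the matrix fixes each basis vector. In other words, `sharp` inverts u ↦
ω(·, u), so every vector is dual to some covector. -/
theorem sharp_flip (ω₀ : V [⋀^Fin 2]→L[ℝ] ℝ) (hω : IsUnit (twoFormMatrix b ω₀).det) (u : V) :
    ∑ i, ∑ j, (poissonEntry b ω₀ i j * bilinOfTwoForm ω₀ (b j) u) • b i = u := by
  have h : (∑ i, (∑ j, poissonEntry b ω₀ i j • (bilinOfTwoForm ω₀ (b j)).toLinearMap).smulRight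
      (b i)) = LinearMap.id := by
    refine b.ext fun l => ?_
    simp [sum_poissonEntry_mul b ω₀ hω, Matrix.one_apply]
  have := congrArg (fun f => f u) h
  simpa [Finset.sum_smul] using this

/-- `∑ᵢⱼ (ω⁻¹)ⁱʲ i_{bⱼ}ω ∧ i_{bᵢ}η = k η` for a `k`-form `η`. -/
theorem sum_wedgeOne_curryLeft (ω₀ : V [⋀^Fin 2]→L[ℝ] ℝ) (hω : IsUnit (twoFormMatrix b ω₀).det)
    (η : V [⋀^Fin (k + 1)]→L[ℝ] ℝ) :
    ∑ i, ∑ j, poissonEntry b ω₀ i j •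
      wedgeOne (bilinOfTwoForm ω₀ (b j)) (η.curryLeft (b i)) = ((k + 1 : ℕ) : ℝ) • η := by
  ext u
  simp only [ContinuousAlternatingMap.sum_apply, ContinuousAlternatingMap.smul_apply,
    wedgeOne_apply, smul_eq_mul, Finset.mul_sum]
  rw [show ((k + 1 : ℕ) : ℝ) * η u = ∑ p : Fin (k + 1), η u by simp]
  simp_rw [Finset.sum_comm (s := Finset.univ (α := ι)) (t := Finset.univ (α := Fin (k + 1)))]
  refine Finset.sum_congr rfl fun p _ => ?_
  -- For each slot `p` the double sum rebuilds the vector `u p`, so each of the k + 1 slots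
  -- contributes `η u`.
  have h := congrArg (fun v => η.curryLeft v (p.removeNth u)) (sharp_flip b ω₀ hω (u p))
  simp only [map_sum, map_smul, ContinuousAlternatingMap.sum_apply,
    ContinuousAlternatingMap.smul_apply, smul_eq_mul] at h
  have h2 : η.curryLeft (u p) (p.removeNth u) = (-1) ^ (p : ℕ) * η u := by
    have := η.map_insertNth p (u p) (p.removeNth u)
    rw [Fin.insertNth_self_removeNth] at this
    rw [this, curryLeft_apply_apply]
    simp [← mul_assoc, ← mul_pow]
  rw [h2] at h
  calc _ = (-1) ^ (p : ℕ) * ∑ i, ∑ j, poissonEntry b ω₀ i j *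
        bilinOfTwoForm ω₀ (b j) (u p) * η.curryLeft (b i) (p.removeNth u) := by
        simp only [Finset.mul_sum]
        refine Finset.sum_congr rfl fun i _ => Finset.sum_congr rfl fun j _ => ?_
        simp
        ring
    _ = η u := by
      rw [h, ← mul_assoc, ← mul_pow]
      simp

theorem sum_wedgeOne_curryLeft' (ω₀ : V [⋀^Fin 2]→L[ℝ] ℝ) (hω : IsUnit (twoFormMatrix b ω₀).det)
    (η : V [⋀^Fin (k + 1)]→L[ℝ] ℝ) :
    ∑ i, ∑ j, poissonEntry b ω₀ i j •
      wedgeOne (bilinOfTwoForm ω₀ (b i)) (η.curryLeft (b j)) = -((k + 1 : ℕ) : ℝ) • η := by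
  rw [Finset.sum_comm, neg_smul (_ : ℝ) η, ← sum_wedgeOne_curryLeft b ω₀ hω η, ← Finset.sum_neg_distrib]
  refine Finset.sum_congr rfl fun i _ => ?_
  rw [← Finset.sum_neg_distrib]
  refine Finset.sum_congr rfl fun j _ => ?_
  rw [poissonEntry_swap b ω₀ hω]
  module

theorem sum_bilin (ω₀ : V [⋀^Fin 2]→L[ℝ] ℝ) (hω : IsUnit (twoFormMatrix b ω₀).det) :
    ∑ i, ∑ j, poissonEntry b ω₀ i j * bilinOfTwoForm ω₀ (b j) (b i) = Fintype.card ι := by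
  simp [sum_poissonEntry_mul b ω₀ hω]

theorem lefschetzDual_apply (ω₀ : V [⋀^Fin 2]→L[ℝ] ℝ) (η : V [⋀^Fin (k + 2)]→L[ℝ] ℝ) :
    lefschetzDual b ω₀ η = (1 / 2 : ℝ) • ∑ i, ∑ j,
      poissonEntry b ω₀ i j • (η.curryLeft (b j)).curryLeft (b i) := rfl

theorem lefschetzDual_wedgeTwo_fin_zero (ω₀ : V [⋀^Fin 2]→L[ℝ] ℝ)
    (hω : IsUnit (twoFormMatrix b ω₀).det) (η : V [⋀^Fin 0]→L[ℝ] ℝ) :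
    lefschetzDual b ω₀ (wedgeTwo ω₀ η) = (Fintype.card ι / 2 : ℝ) • η := by
  simp only [lefschetzDual_apply, curryLeft_wedgeTwo_fin_zero, wedgeOne_fin_zero, smul_smul,
    ← Finset.sum_smul, sum_bilin b ω₀ hω]
  congr 1
  ring

theorem lefschetzDual_wedgeTwo_fin_one (ω₀ : V [⋀^Fin 2]→L[ℝ] ℝ)
    (hω : IsUnit (twoFormMatrix b ω₀).det) (η : V [⋀^Fin 1]→L[ℝ] ℝ) :
    lefschetzDual b ω₀ (wedgeTwo ω₀ η) = (Fintype.card ι / 2 - 1 : ℝ) • η := by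
  simp only [lefschetzDual_apply, curryLeft_wedgeTwo, curryLeft_wedgeTwo_fin_zero,
    curryLeft_add', curryLeft_wedgeOne, smul_add, smul_sub, Finset.sum_add_distrib,
    Finset.sum_sub_distrib, smul_smul]
  simp only [← Finset.sum_smul, sum_bilin b ω₀ hω, sum_wedgeOne_curryLeft b ω₀ hω,
    sum_wedgeOne_curryLeft' b ω₀ hω]
  push_cast
  module

/-- Besides ω ∧ Λη, contracting ω ∧ η twice produces a trace term (dim V)η and two cross terms of
the form i_bω ∧ i_{b'}η, each summing to -(k + 2)η. The 1/2 in Λ turns this into dim V / 2 - (k +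
2). Degrees 0 and 1 are separate because some of these terms do not exist there. -/
theorem lefschetzDual_wedgeTwo (ω₀ : V [⋀^Fin 2]→L[ℝ] ℝ)
    (hω : IsUnit (twoFormMatrix b ω₀).det) (η : V [⋀^Fin (k + 2)]→L[ℝ] ℝ) :
    lefschetzDual b ω₀ (wedgeTwo ω₀ η) =
      wedgeTwo ω₀ (lefschetzDual b ω₀ η) + (Fintype.card ι / 2 - (k + 2 : ℕ) : ℝ) • η := by
  let W : (V [⋀^Fin k]→L[ℝ] ℝ) →ₗ[ℝ] (V [⋀^Fin (k + 2)]→L[ℝ] ℝ) :=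
    { toFun := wedgeTwo ω₀, map_add' := wedgeTwo_add ω₀, map_smul' := wedgeTwo_smul ω₀ }
  have hW : wedgeTwo ω₀ (lefschetzDual b ω₀ η) = (1 / 2 : ℝ) • ∑ i, ∑ j,
      poissonEntry b ω₀ i j • wedgeTwo ω₀ ((η.curryLeft (b j)).curryLeft (b i)) := by
    change W _ = _
    rw [lefschetzDual_apply, map_smul, map_sum]
    simp only [map_sum, map_smul]
    rfl
  rw [hW]
  simp only [lefschetzDual_apply, curryLeft_wedgeTwo,
    curryLeft_add', curryLeft_wedgeOne, smul_add, smul_sub, Finset.sum_add_distrib,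
    Finset.sum_sub_distrib, smul_smul]
  simp only [← Finset.sum_smul, sum_bilin b ω₀ hω, sum_wedgeOne_curryLeft b ω₀ hω,
    sum_wedgeOne_curryLeft' b ω₀ hω]
  push_cast
  module

theorem curryLeft_sharp (ω₀ : V [⋀^Fin 2]→L[ℝ] ℝ) (α : V →L[ℝ] ℝ)
    (η : V [⋀^Fin (k + 1)]→L[ℝ] ℝ) : η.curryLeft (sharp b ω₀ α) =
      ∑ i, ∑ j, (poissonEntry b ω₀ i j * α (b j)) • η.curryLeft (b i) := by
  simp only [sharp, map_sum, map_smul]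

theorem curryLeft_sharp' (ω₀ : V [⋀^Fin 2]→L[ℝ] ℝ) (hω : IsUnit (twoFormMatrix b ω₀).det)
    (α : V →L[ℝ] ℝ) (η : V [⋀^Fin (k + 1)]→L[ℝ] ℝ) : η.curryLeft (sharp b ω₀ α) =
      -∑ i, ∑ j, (poissonEntry b ω₀ i j * α (b i)) • η.curryLeft (b j) := by
  rw [Finset.sum_comm, curryLeft_sharp, ← Finset.sum_neg_distrib]
  refine Finset.sum_congr rfl fun i _ => ?_
  rw [← Finset.sum_neg_distrib]
  refine Finset.sum_congr rfl fun j _ => ?_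
  rw [poissonEntry_swap b ω₀ hω, neg_mul, neg_smul]

/-- `[Λ, α ∧ ·]` is the contraction with the vector dual to `α`. -/
theorem lefschetzDual_wedgeOne (ω₀ : V [⋀^Fin 2]→L[ℝ] ℝ)
    (hω : IsUnit (twoFormMatrix b ω₀).det) (α : V →L[ℝ] ℝ) (η : V [⋀^Fin (k + 2)]→L[ℝ] ℝ) :
    lefschetzDual b ω₀ (wedgeOne α η) =
      η.curryLeft (sharp b ω₀ α) + wedgeOne α (lefschetzDual b ω₀ η) := by
  -- The two cross terms are the same contraction with `sharp`, by antisymmetry of ω⁻¹, which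
  -- absorbs the factor 1/2.
  have h1 := curryLeft_sharp b ω₀ α η
  have h2 := curryLeft_sharp' b ω₀ hω α η
  rw [eq_neg_iff_add_eq_zero, ← eq_neg_iff_add_eq_zero, eq_comm, neg_eq_iff_eq_neg] at h2
  simp only [lefschetzDual_apply, curryLeft_wedgeOne, curryLeft_sub', curryLeft_smul',
    smul_sub, Finset.sum_sub_distrib, smul_smul, map_smul, map_sum,
    ← h1, h2]
  module

theorem lefschetzDual_wedgeOne_fin_one (ω₀ : V [⋀^Fin 2]→L[ℝ] ℝ)
    (hω : IsUnit (twoFormMatrix b ω₀).det) (α : V →L[ℝ] ℝ) (η : V [⋀^Fin 1]→L[ℝ] ℝ) :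
    lefschetzDual b ω₀ (wedgeOne α η) = η.curryLeft (sharp b ω₀ α) := by
  have h1 := curryLeft_sharp b ω₀ α η
  have h2 := curryLeft_sharp' b ω₀ hω α η
  rw [eq_neg_iff_add_eq_zero, ← eq_neg_iff_add_eq_zero, eq_comm, neg_eq_iff_eq_neg] at h2
  simp only [lefschetzDual_apply, curryLeft_wedgeOne, wedgeOne_fin_zero, curryLeft_sub',
    curryLeft_smul',
    smul_sub, Finset.sum_sub_distrib, smul_smul, ← h1, h2]
  module

end Basis

end PointwiseAlgebra
end SymplecticForms

namespace SymplecticForms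

/-! ### Consequences of [Λ, L] = n - k: bijectivity of ΛL below the middle degree. -/

section LefschetzAction

/-- Operators `L` and `Λ` of degree `2` and `-2` on a graded vector space with `[Λ, L] = n - k` in
degree `k`. -/
structure LefschetzAction (n : ℕ) (G : ℕ → Type*) [∀ k, AddCommGroup (G k)]
    [∀ k, Module ℝ (G k)] where
  /-- the raising operator -/
  L (k : ℕ) : G k →ₗ[ℝ] G (k + 2)
  /-- the lowering operator -/
  dual (k : ℕ) : G (k + 2) →ₗ[ℝ] G k
  dual_L_zero (a : G 0) : dual 0 (L 0 a) = (n : ℝ) • a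
  dual_L_one (a : G 1) : dual 1 (L 1 a) = (n - 1 : ℝ) • a
  dual_L (k : ℕ) (a : G (k + 2)) :
    dual (k + 2) (L (k + 2) a) = L k (dual k a) + (n - (k + 2 : ℕ) : ℝ) • a

namespace LefschetzAction

variable {n : ℕ} {G : ℕ → Type*} [∀ k, AddCommGroup (G k)] [∀ k, Module ℝ (G k)]
  (A : LefschetzAction n G)

/-- Induction in steps of two. In degree k + 2 the hypothesis reads LΛa + ea = 0 with e = n - (k +
2) + c > 0. Applying Λ gives (ΛL + e)(Λa) = 0 two degrees lower, so Λa = 0 and then ea = 0. The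
shift `c` is there to make the induction close. -/
theorem eq_zero_of_dual_L_add_smul : ∀ (k : ℕ), k < n → ∀ (c : ℝ), 0 ≤ c → ∀ a : G k,
    A.dual k (A.L k a) + c • a = 0 → a = 0
  | 0, hk, c, hc, a, h => by
    rw [A.dual_L_zero, ← add_smul] at h
    have : (0 : ℝ) < n := by exact_mod_cast hk
    exact (smul_eq_zero.1 h).resolve_left (by positivity)
  | 1, hk, c, hc, a, h => by
    rw [A.dual_L_one, ← add_smul] at h
    have : (1 : ℝ) < n := by exact_mod_cast hk
    exact (smul_eq_zero.1 h).resolve_left (by linarith)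
  | k + 2, hk, c, hc, a, h => by
    have hk' : ((k + 2 : ℕ) : ℝ) < n := by exact_mod_cast hk
    rw [A.dual_L, add_assoc, ← add_smul] at h
    have h1 : A.dual k a = 0 := by
      refine eq_zero_of_dual_L_add_smul k (by omega) (n - (k + 2 : ℕ) + c) (by linarith) _ ?_
      have := congrArg (A.dual k) h
      rwa [map_add, map_smul, map_zero] at this
    rw [h1, map_zero, zero_add] at h
    exact (smul_eq_zero.1 h).resolve_left (by linarith)

theorem exists_dual_L_add_smul : ∀ (k : ℕ), k < n → ∀ (c : ℝ), 0 ≤ c → ∀ b : G k,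
    ∃ a : G k, A.dual k (A.L k a) + c • a = b
  | 0, hk, c, hc, b => by
    have : (0 : ℝ) < n := by exact_mod_cast hk
    refine ⟨((n + c : ℝ)⁻¹) • b, ?_⟩
    rw [A.dual_L_zero, ← add_smul, smul_smul, mul_inv_cancel₀ (by positivity), one_smul]
  | 1, hk, c, hc, b => by
    have : (1 : ℝ) < n := by exact_mod_cast hk
    refine ⟨((n - 1 + c : ℝ)⁻¹) • b, ?_⟩
    rw [A.dual_L_one, ← add_smul, smul_smul, mul_inv_cancel₀ (by linarith), one_smul]
  | k + 2, hk, c, hc, b => by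
    have hk' : ((k + 2 : ℕ) : ℝ) < n := by exact_mod_cast hk
    obtain ⟨e, he⟩ : ∃ e : ℝ, e = n - (k + 2 : ℕ) + c := ⟨_, rfl⟩
    have he0 : 0 < e := by linarith
    -- `γ` is the prospective Λa: the equation LΛa + ea = b forces a = e⁻¹(b - Lγ), and applying Λ
    -- to it gives (ΛL + e)γ = Λb.
    obtain ⟨γ, hγ⟩ := exists_dual_L_add_smul k (by omega) e he0.le (A.dual k b)
    refine ⟨e⁻¹ • (b - A.L k γ), ?_⟩
    rw [A.dual_L, add_assoc, ← add_smul, ← he, smul_smul, mul_inv_cancel₀ he0.ne', one_smul,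
      map_smul, map_smul, map_sub, sub_eq_of_eq_add' hγ.symm, map_smul, smul_smul,
      inv_mul_cancel₀ he0.ne', one_smul]
    abel

theorem L_injective {k : ℕ} (hk : k < n) {a : G k} (h : A.L k a = 0) : a = 0 :=
  A.eq_zero_of_dual_L_add_smul k hk 0 le_rfl a (by rw [h, map_zero, zero_smul, add_zero])

theorem eq_zero_of_dual_L {k : ℕ} (hk : k < n) {a : G k} (h : A.dual k (A.L k a) = 0) : a = 0 :=
  A.eq_zero_of_dual_L_add_smul k hk 0 le_rfl a (by rw [h, zero_smul, add_zero])

theorem exists_dual_sub_L {k : ℕ} (hk : k < n) (b : G (k + 2)) :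
    ∃ a : G k, A.dual k (b - A.L k a) = 0 := by
  obtain ⟨a, ha⟩ := A.exists_dual_L_add_smul k hk 0 le_rfl (A.dual k b)
  refine ⟨a, ?_⟩
  rw [map_sub, sub_eq_zero, ← ha, zero_smul, add_zero]

end LefschetzAction

end LefschetzAction

/-! ### Behaviour of Λ under linear changes of coordinates. -/

section Naturality

variable {V : Type*} [NormedAddCommGroup V] [NormedSpace ℝ V] {k : ℕ}

theorem eq_zero_of_finrank_lt [FiniteDimensional ℝ V] (hk : Module.finrank ℝ V < k)
    (η : V [⋀^Fin k]→L[ℝ] ℝ) : η = 0 := by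
  ext v
  refine η.toAlternatingMap.map_linearDependent v fun h => ?_
  have := h.fintype_card_le_finrank
  rw [Fintype.card_fin] at this
  omega

variable {ι : Type*} [Fintype ι] [DecidableEq ι] (b : Module.Basis ι ℝ V)

theorem twoFormMatrix_compContinuousLinearMap (ω₀ : V [⋀^Fin 2]→L[ℝ] ℝ) (A : V →L[ℝ] V) :
    twoFormMatrix b (ω₀.compContinuousLinearMap A) =
      (LinearMap.toMatrix b b A.toLinearMap).transpose * twoFormMatrix b ω₀ *
        LinearMap.toMatrix b b A.toLinearMap := by
  ext i j
  have hA : ∀ i, A (b i) = ∑ p, LinearMap.toMatrix b b A.toLinearMap p i • b p := fun i => by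
    simp only [LinearMap.toMatrix_apply]
    exact (b.sum_repr _).symm
  have h1 : bilinOfTwoForm (ω₀.compContinuousLinearMap A) (b i) (b j) =
      bilinOfTwoForm ω₀ (A (b i)) (A (b j)) := by
    rw [bilinOfTwoForm_apply, bilinOfTwoForm_apply,
      ContinuousAlternatingMap.compContinuousLinearMap_apply]
    congr 1
    ext l
    fin_cases l <;> rfl
  rw [twoFormMatrix_apply, h1, hA, hA, Matrix.mul_apply]
  simp only [Matrix.mul_apply, Matrix.transpose_apply, map_sum, map_smul,
    sum_apply, smul_apply, smul_eq_mul, twoFormMatrix_apply]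
  refine Finset.sum_congr rfl fun q _ => ?_
  rw [mul_comm]

/-- If the matrix W of ω becomes AᵀWA, then A(AᵀWA)⁻¹Aᵀ = W⁻¹, which is exactly how the pair of
contractions transforms. This lets Λ, defined pointwise in the frame of each point's own chart, be
computed in any fixed chart. -/
theorem lefschetzDual_compContinuousLinearMap (ω₀ : V [⋀^Fin 2]→L[ℝ] ℝ)
    (η : V [⋀^Fin (k + 2)]→L[ℝ] ℝ) (A : V →L[ℝ] V)
    (hA : IsUnit (LinearMap.toMatrix b b A.toLinearMap).det) :
    lefschetzDual b (ω₀.compContinuousLinearMap A) (η.compContinuousLinearMap A) =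
      (lefschetzDual b ω₀ η).compContinuousLinearMap A := by
  obtain ⟨a, ha⟩ : ∃ a, a = LinearMap.toMatrix b b A.toLinearMap := ⟨_, rfl⟩
  have hAb : ∀ i, A (b i) = ∑ p, a p i • b p := fun i => by
    simp only [ha, LinearMap.toMatrix_apply]
    exact (b.sum_repr _).symm
  have hinv : a * (twoFormMatrix b (ω₀.compContinuousLinearMap A))⁻¹ * a.transpose =
      (twoFormMatrix b ω₀)⁻¹ := by
    rw [twoFormMatrix_compContinuousLinearMap, ← ha, Matrix.mul_inv_rev, Matrix.mul_inv_rev,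
      Matrix.mul_nonsing_inv_cancel_left _ _ (ha ▸ hA), Matrix.mul_assoc,
      Matrix.nonsing_inv_mul _ (by rw [Matrix.det_transpose]; exact ha ▸ hA), Matrix.mul_one]
  have hp : ∀ p q, poissonEntry b ω₀ p q =
      ∑ i, ∑ j, a p i * poissonEntry b (ω₀.compContinuousLinearMap A) i j * a q j := fun p q => by
    rw [poissonEntry, ← hinv, Matrix.mul_apply, Finset.sum_comm]
    refine Finset.sum_congr rfl fun j _ => ?_
    rw [Matrix.mul_apply, Finset.sum_mul]
    rfl
  ext u
  simp only [lefschetzDual_apply, ContinuousAlternatingMap.compContinuousLinearMap_apply,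
    ContinuousAlternatingMap.smul_apply, ContinuousAlternatingMap.sum_apply]
  congr 1
  have h1 : ∀ i j, ((((η.compContinuousLinearMap A).curryLeft (b j)).curryLeft (b i)) u) =
      ∑ p, ∑ q, a p i * a q j * ((η.curryLeft (b q)).curryLeft (b p)) (A ∘ u) := fun i j => by
    rw [ContinuousAlternatingMap.curryLeft_compContinuousLinearMap,
      ContinuousAlternatingMap.curryLeft_compContinuousLinearMap, hAb, hAb,
      ContinuousAlternatingMap.compContinuousLinearMap_apply]
    let H : V →L[ℝ] V →L[ℝ] V [⋀^Fin k]→L[ℝ] ℝ :=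
      (ContinuousAlternatingMap.curryLeftLI (𝕜 := ℝ) (E := V) (F := ℝ)).toContinuousLinearMap ∘L
        η.curryLeft
    change H (∑ q, a q j • b q) (∑ p, a p i • b p) (A ∘ u) =
      ∑ p, ∑ q, a p i * a q j * H (b q) (b p) (A ∘ u)
    simp only [map_sum, map_smul, sum_apply, smul_apply, ContinuousAlternatingMap.sum_apply,
      ContinuousAlternatingMap.smul_apply, smul_eq_mul, Finset.mul_sum]
    refine Finset.sum_congr rfl fun p _ => Finset.sum_congr rfl fun q _ => ?_
    ring
  simp only [h1, hp, smul_eq_mul, Finset.mul_sum, Finset.sum_mul]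
  calc _ = ∑ i, ∑ p, ∑ j, ∑ q, poissonEntry b (ω₀.compContinuousLinearMap A) i j *
        (a p i * a q j * ((η.curryLeft (b q)).curryLeft (b p)) (A ∘ u)) :=
        Finset.sum_congr rfl fun i _ => Finset.sum_comm
    _ = ∑ p, ∑ i, ∑ q, ∑ j, poissonEntry b (ω₀.compContinuousLinearMap A) i j *
        (a p i * a q j * ((η.curryLeft (b q)).curryLeft (b p)) (A ∘ u)) := by
        rw [Finset.sum_comm]
        exact Finset.sum_congr rfl fun p _ => Finset.sum_congr rfl fun i _ => Finset.sum_comm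
    _ = _ := by
        refine Finset.sum_congr rfl fun p _ => ?_
        rw [Finset.sum_comm]
        refine Finset.sum_congr rfl fun q _ => Finset.sum_congr rfl fun i _ =>
          Finset.sum_congr rfl fun j _ => ?_
        change _ = _ * ((η.curryLeft (b q)).curryLeft (b p)) (A ∘ u)
        ring

end Naturality

end SymplecticForms

namespace SymplecticForms

/-! ### Smooth dependence of Λ on the symplectic form. -/

section SmoothDual

variable {V : Type*} [NormedAddCommGroup V] [NormedSpace ℝ V] {k : ℕ}
  {ι : Type*} [Fintype ι] [DecidableEq ι] (b : Module.Basis ι ℝ V)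

theorem contDiffWithinAt_det {W : Type*} [NormedAddCommGroup W] [NormedSpace ℝ W] {s : Set W}
    {x : W} {m : WithTop ℕ∞} {A : W → Matrix ι ι ℝ}
    (hA : ∀ i j, ContDiffWithinAt ℝ m (fun y => A y i j) s x) :
    ContDiffWithinAt ℝ m (fun y => (A y).det) s x := by
  simp only [Matrix.det_apply']
  refine ContDiffWithinAt.sum fun σ _ => ?_
  have h : ContDiffWithinAt ℝ m (fun y => ∏ i, A y (σ i) i) s x :=
    contDiffWithinAt_prod (f := fun i y => A y (σ i) i) fun i _ => hA (σ i) i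
  exact (contDiffWithinAt_const (c := (((Equiv.Perm.sign σ : ℤˣ) : ℤ) : ℝ))).mul h

theorem contDiffWithinAt_poissonEntry {s : Set V} {x : V} {m : WithTop ℕ∞}
    {f : V → V [⋀^Fin 2]→L[ℝ] ℝ} (hf : ContDiffWithinAt ℝ m f s x)
    (h0 : IsUnit (twoFormMatrix b (f x)).det) (i j : ι) :
    ContDiffWithinAt ℝ m (fun y => poissonEntry b (f y) i j) s x := by
  have hev : ∀ v w : V, ContDiffWithinAt ℝ m (fun y => f y ![v, w]) s x := fun v w =>
    (ContinuousAlternatingMap.apply ℝ V ℝ ![v, w]).contDiff.comp_contDiffWithinAt hf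
  have hdet : ContDiffWithinAt ℝ m (fun y => (twoFormMatrix b (f y)).det) s x :=
    contDiffWithinAt_det fun i j => hev _ _
  -- Cramer's rule: both determinants are polynomial in the entries, and the one inverted is nonzero
  -- at `x`.
  have e : (fun y => poissonEntry b (f y) i j) = fun y => ((twoFormMatrix b (f y)).det)⁻¹ *
      ((twoFormMatrix b (f y)).updateRow j (Pi.single i 1)).det := by
    funext y
    rw [poissonEntry, Matrix.inv_def, Ring.inverse_eq_inv']
    exact congrArg _ (Matrix.adjugate_apply _ _ _)
  rw [e]
  refine (hdet.inv h0.ne_zero).mul (contDiffWithinAt_det fun p q => ?_)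
  by_cases h : p = j
  · subst h
    simp only [Matrix.updateRow_self]
    exact contDiffWithinAt_const
  · simp only [Matrix.updateRow_ne h]
    exact hev _ _

theorem contDiffWithinAt_lefschetzDual {s : Set V} {x : V} {m : WithTop ℕ∞}
    {f : V → V [⋀^Fin 2]→L[ℝ] ℝ} {g : V → V [⋀^Fin (k + 2)]→L[ℝ] ℝ}
    (hf : ContDiffWithinAt ℝ m f s x) (hg : ContDiffWithinAt ℝ m g s x)
    (h0 : IsUnit (twoFormMatrix b (f x)).det) :
    ContDiffWithinAt ℝ m (fun y => lefschetzDual b (f y) (g y)) s x := by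
  simp only [lefschetzDual_apply]
  refine ContDiffWithinAt.const_smul _ (ContDiffWithinAt.sum fun i _ => ContDiffWithinAt.sum
    fun j _ => (contDiffWithinAt_poissonEntry b hf h0 i j).smul ?_)
  have h1 : ContDiffWithinAt ℝ m (fun y => (g y).curryLeft (b j)) s x :=
    ((ContinuousAlternatingMap.curryLeftLI (𝕜 := ℝ) (E := V) (F := ℝ)
      (n := k + 1)).toContinuousLinearMap.contDiff.comp_contDiffWithinAt hg).clm_apply
      contDiffWithinAt_const
  exact ((ContinuousAlternatingMap.curryLeftLI (𝕜 := ℝ) (E := V) (F := ℝ)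
      (n := k)).toContinuousLinearMap.contDiff.comp_contDiffWithinAt h1).clm_apply
      contDiffWithinAt_const

end SmoothDual

/-! ### Smooth operators on forms: Λ, df ∧ ·, Hamiltonian contraction and the Poisson bracket. -/

section Operators

variable {E : Type*} [NormedAddCommGroup E] [NormedSpace ℝ E]
  {H : Type*} [TopologicalSpace H] {I : ModelWithCorners ℝ E H}
  {M : Type*} [TopologicalSpace M] [ChartedSpace H M] [IsManifold I ∞ M] {k : ℕ}

theorem Form.ext {η ζ : Form I M k} (h : ∀ x, η.1 x = ζ.1 x) : η = ζ := Subtype.ext (funext h)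

theorem Form.sub_apply (η ζ : Form I M k) (x : M) : (η - ζ).1 x = η.1 x - ζ.1 x := rfl

theorem Form.zero_apply (x : M) : (0 : Form I M k).1 x = 0 := rfl

theorem wedge_apply (ω₀ : Form I M 2) (η : Form I M k) (x : M) :
    (wedge ω₀ η).1 x = wedgeTwo (ω₀.1 x) (η.1 x) := rfl

theorem mulForm_apply (f : C^∞⟮I, M; ℝ⟯) (η : Form I M k) (x : M) :
    (mulForm f η).1 x = f x • η.1 x := rfl

theorem isUnit_det_tangentCoordChange {ι : Type*} [Fintype ι] [DecidableEq ι]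
    (b : Module.Basis ι ℝ E) {x₀ z : M} (hz : z ∈ (extChartAt I x₀).source) :
    IsUnit (LinearMap.toMatrix b b (tangentCoordChange I x₀ z z).toLinearMap).det := by
  have h : (tangentCoordChange I z x₀ z).toLinearMap ∘ₗ (tangentCoordChange I x₀ z z).toLinearMap =
      LinearMap.id := by
    ext v
    change tangentCoordChange I z x₀ z (tangentCoordChange I x₀ z z v) = v
    rw [tangentCoordChange_comp ⟨⟨hz, mem_extChartAt_source z⟩, hz⟩, tangentCoordChange_self hz]
  refine Matrix.isUnit_det_of_left_inverse (B := LinearMap.toMatrix b b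
    (tangentCoordChange I z x₀ z).toLinearMap) ?_
  rw [← LinearMap.toMatrix_comp, h, LinearMap.toMatrix_id]

theorem SymplecticForm.isUnit_det {ι : Type*} [Fintype ι] [DecidableEq ι]
    (b : Module.Basis ι ℝ E) (ω₀ : SymplecticForm I M) (x : M) :
    IsUnit (twoFormMatrix b (ω₀.form.1 x)).det :=
  isUnit_det_twoFormMatrix b _ (ω₀.nondegenerate x)

theorem SymplecticForm.isUnit_det_inChart {ι : Type*} [Fintype ι] [DecidableEq ι]
    (b : Module.Basis ι ℝ E) (ω₀ : SymplecticForm I M) {x₀ : M} {y : E}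
    (hy : y ∈ (extChartAt I x₀).target) :
    IsUnit (twoFormMatrix b (inChart I ω₀.form.1 x₀ y)).det := by
  rw [inChart, twoFormMatrix_compContinuousLinearMap, Matrix.det_mul, Matrix.det_mul,
    Matrix.det_transpose]
  have := isUnit_det_tangentCoordChange b ((extChartAt I x₀).map_target hy)
  exact (this.mul (ω₀.isUnit_det b _)).mul this

section Dual

variable [FiniteDimensional ℝ E]

/-- The dual Lefschetz operator `Λ` on smooth forms. -/
noncomputable def dualForm (ω₀ : SymplecticForm I M) : Form I M (k + 2) →ₗ[ℝ] Form I M k where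
  toFun η := ⟨fun x => lefschetzDual (Module.finBasis ℝ E) (ω₀.form.1 x) (η.1 x), fun x₀ => by
    -- By naturality, Λ taken in the frame at each point agrees with Λ in the frame of the chart at
    -- `x₀`, where the coefficients are visibly smooth.
    have h : ∀ y ∈ (extChartAt I x₀).target,
        inChart I (fun x => lefschetzDual (Module.finBasis ℝ E) (ω₀.form.1 x) (η.1 x)) x₀ y =
          lefschetzDual (Module.finBasis ℝ E) (inChart I ω₀.form.1 x₀ y) (inChart I η.1 x₀ y) :=
      fun y hy => (lefschetzDual_compContinuousLinearMap _ _ _ _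
        (isUnit_det_tangentCoordChange _ ((extChartAt I x₀).map_target hy))).symm
    exact ContDiffOn.congr (fun y hy => contDiffWithinAt_lefschetzDual _ (ω₀.form.2 x₀ y hy)
      (η.2 x₀ y hy) (ω₀.isUnit_det_inChart _ hy)) h⟩
  map_add' η ζ := Subtype.ext <| funext fun x => map_add (lefschetzDual _ _) (η.1 x) (ζ.1 x)
  map_smul' c η := Subtype.ext <| funext fun x => map_smul (lefschetzDual _ _) c (η.1 x)

theorem dualForm_apply (ω₀ : SymplecticForm I M) (η : Form I M (k + 2)) (x : M) :
    (dualForm ω₀ η).1 x = lefschetzDual (Module.finBasis ℝ E) (ω₀.form.1 x) (η.1 x) := rfl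

variable {n : ℕ} (hn : Module.finrank ℝ E = 2 * n)
include hn

omit [FiniteDimensional ℝ E] [IsManifold I ∞ M] in
theorem card_div_two : (Fintype.card (Fin (Module.finrank ℝ E)) / 2 : ℝ) = n := by
  rw [Fintype.card_fin, hn]
  push_cast
  ring

end Dual

theorem d_d (η : Form I M k) : d (d η) = 0 := by
  refine Form.ext fun x => ?_
  have hx := mem_extChartAt_target (I := I) x
  have hxr : extChartAt I x x ∈ range I := mem_range_self _
  have hev : inChart I (d η).1 x =ᶠ[𝓝[range I] (extChartAt I x x)]
      extDerivWithin (inChart I η.1 x) (range I) := by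
    filter_upwards [extChartAt_target_mem_nhdsWithin (I := I) x] with y hy
    exact inChart_d η hy
  change extDerivWithin (inChart I (d η).1 x) (range I) (extChartAt I x x) = 0
  rw [hev.extDerivWithin_eq_of_mem hxr]
  exact extDerivWithin_extDerivWithin_apply (r := ∞) (form_contDiffWithinAt η hx)
    (by rw [minSmoothness_of_isRCLikeNormedField]
        exact WithTop.coe_le_coe.2 (le_top : (2 : ℕ∞) ≤ ⊤)) I.uniqueDiffOn
    (I.range_subset_closure_interior hxr) hxr

/-- The differential of a function at `x`, as a covector in the preferred chart. -/
noncomputable def covec (f : C^∞⟮I, M; ℝ⟯) (x : M) : E →L[ℝ] ℝ :=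
  fderivWithin ℝ (fun y => f ((extChartAt I x).symm y)) (range I) (extChartAt I x x)

theorem contDiffWithinAt_inChart_fn (f : C^∞⟮I, M; ℝ⟯) (x : M) :
    ContDiffWithinAt ℝ ∞ (fun y => f ((extChartAt I x).symm y)) (range I) (extChartAt I x x) :=
  ((f.contMDiff.comp_contMDiffOn (contMDiffOn_extChartAt_symm x)).contDiffOn _
    (mem_extChartAt_target x)).mono_of_mem_nhdsWithin (extChartAt_target_mem_nhdsWithin x)

theorem d_mulForm_apply (f : C^∞⟮I, M; ℝ⟯) (η : Form I M k) (x : M) :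
    (d (mulForm f η)).1 x = wedgeOne (covec f x) (η.1 x) + f x • (d η).1 x := by
  have hx := mem_extChartAt_target (I := I) x
  have h1 := (contDiffWithinAt_inChart_fn f x).differentiableWithinAt (by simp)
  have h2 := form_differentiableWithinAt η hx
  have hs : UniqueDiffWithinAt ℝ (range I) (extChartAt I x x) :=
    I.uniqueDiffOn _ (mem_range_self _)
  have e : inChart I (mulForm f η).1 x =
      fun y => f ((extChartAt I x).symm y) • inChart I η.1 x y := rfl
  change extDerivWithin (inChart I (mulForm f η).1 x) (range I) (extChartAt I x x) = _
  rw [e, extDerivWithin, fderivWithin_fun_smul hs h1 h2,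
    ContinuousAlternatingMap.alternatizeUncurryFin_add,
    ContinuousAlternatingMap.alternatizeUncurryFin_smul, inChart_self, extChartAt_to_inv]
  exact add_comm _ _

/-- The operator `η ↦ df ∧ η` on smooth forms. -/
noncomputable def dWedge (f : C^∞⟮I, M; ℝ⟯) : Form I M k →ₗ[ℝ] Form I M (k + 1) :=
  d ∘ₗ mulForm f - mulForm f ∘ₗ d

theorem dWedge_apply (f : C^∞⟮I, M; ℝ⟯) (η : Form I M k) (x : M) :
    (dWedge f η).1 x = wedgeOne (covec f x) (η.1 x) := by
  change (d (mulForm f η)).1 x - f x • (d η).1 x = _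
  rw [d_mulForm_apply, add_sub_cancel_right]

/-- The contraction of forms with the Hamiltonian vector field of a function, as the commutator of
`Λ` and `df ∧ ·`. -/
noncomputable def hamContract [FiniteDimensional ℝ E] (ω₀ : SymplecticForm I M)
    (f : C^∞⟮I, M; ℝ⟯) : (k : ℕ) → Form I M (k + 1) →ₗ[ℝ] Form I M k
  -- On 1-forms Λ is zero, so only one term of the commutator remains.
  | 0 => dualForm ω₀ ∘ₗ dWedge f
  | _ + 1 => dualForm ω₀ ∘ₗ dWedge f - dWedge f ∘ₗ dualForm ω₀

/-- The Hamiltonian vector field of a function. -/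
noncomputable def hamVec [FiniteDimensional ℝ E] (ω₀ : SymplecticForm I M)
    (f : C^∞⟮I, M; ℝ⟯) (x : M) : E := sharp (Module.finBasis ℝ E) (ω₀.form.1 x) (covec f x)

/-- Pointwise this is [Λ, α ∧ ·] = contraction with the dual of α. Smoothness of the contraction
therefore comes for free from that of Λ and d, without treating the vector field as a smooth
section. -/
theorem hamContract_apply [FiniteDimensional ℝ E] (ω₀ : SymplecticForm I M)
    (f : C^∞⟮I, M; ℝ⟯) (η : Form I M (k + 1)) (x : M) :
    (hamContract ω₀ f k η).1 x = (η.1 x).curryLeft (hamVec ω₀ f x) := by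
  cases k with
  | zero =>
    change lefschetzDual (Module.finBasis ℝ E) _ ((dWedge f η).1 x) = _
    rw [dWedge_apply]
    exact lefschetzDual_wedgeOne_fin_one _ _ (ω₀.isUnit_det _ x) _ _
  | succ k =>
    change lefschetzDual (Module.finBasis ℝ E) _ ((dWedge f η).1 x) - (dWedge f (dualForm ω₀ η)).1 x = _
    rw [dWedge_apply, dWedge_apply, dualForm_apply, sub_eq_iff_eq_add]
    exact lefschetzDual_wedgeOne _ _ (ω₀.isUnit_det _ x) _ _

/-- The constant `0`-form `1`. -/
noncomputable def oneForm : Form I M 0 :=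
  ⟨fun _ => ContinuousAlternatingMap.constOfIsEmpty ℝ E (Fin 0) 1, fun x₀ => by
    refine (contDiffOn_const (c := ContinuousAlternatingMap.constOfIsEmpty ℝ E (Fin 0) (1 : ℝ))).congr
      fun y _ => ?_
    ext v
    rfl⟩

/-- A smooth `0`-form as a smooth function. -/
noncomputable def formToFn (η : Form I M 0) : C^∞⟮I, M; ℝ⟯ :=
  ⟨fun x => η.1 x 0, fun x => by
    have h1 : ContDiffWithinAt ℝ ∞ (fun y => inChart I η.1 x y 0) (range I) (extChartAt I x x) :=
      (ContinuousAlternatingMap.apply ℝ E ℝ (0 : Fin 0 → E)).contDiff.comp_contDiffWithinAt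
        (form_contDiffWithinAt η (mem_extChartAt_target x))
    rw [contMDiffAt_iff_source]
    refine h1.contMDiffWithinAt.congr (fun y _ => ?_) ?_
    all_goals
      rw [Function.comp_apply, inChart, ContinuousAlternatingMap.compContinuousLinearMap_apply]
      congr 1
      exact Subsingleton.elim _ _⟩

/-- The Poisson bracket of two functions, up to sign. -/
noncomputable def poissonFn [FiniteDimensional ℝ E] (ω₀ : SymplecticForm I M)
    (f g : C^∞⟮I, M; ℝ⟯) : C^∞⟮I, M; ℝ⟯ := formToFn (hamContract ω₀ g 0 (dWedge f oneForm))

theorem poissonFn_apply [FiniteDimensional ℝ E] (ω₀ : SymplecticForm I M)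
    (f g : C^∞⟮I, M; ℝ⟯) (x : M) : poissonFn ω₀ f g x = covec f x (hamVec ω₀ g x) := by
  change (hamContract ω₀ g 0 (dWedge f oneForm)).1 x 0 = _
  rw [hamContract_apply, dWedge_apply, wedgeOne_fin_zero]
  change _ * (1 : ℝ) = _
  rw [mul_one]

end Operators

end SymplecticForms

namespace SymplecticForms

/-! ### The identity [Λ, [Λ, d]] = 0 from sl₂ weights. -/

section Commutators

/-- The iterated commutators `[Λ, [Λ, … [Λ, D]]]`. -/
def iterComm {R : Type*} [Ring R] (Λ D : R) : ℕ → R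
  | 0 => D
  | m + 1 => Λ * iterComm Λ D m - iterComm Λ D m * Λ

variable {R : Type*} [Ring R] [Algebra ℝ R] {L Λ H D : R}

theorem weight_iterComm (hHD : H * D - D * H = -D) (hHΛ : H * Λ - Λ * H = (2 : ℝ) • Λ) (m : ℕ) :
    H * iterComm Λ D m - iterComm Λ D m * H = (2 * m - 1 : ℝ) • iterComm Λ D m := by
  induction m with
  | zero => simpa [iterComm] using hHD
  | succ m ih =>
    have e : H * iterComm Λ D (m + 1) - iterComm Λ D (m + 1) * H =
        (H * Λ - Λ * H) * iterComm Λ D m - iterComm Λ D m * (H * Λ - Λ * H) +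
        (Λ * (H * iterComm Λ D m - iterComm Λ D m * H) -
          (H * iterComm Λ D m - iterComm Λ D m * H) * Λ) := by
      rw [iterComm]
      noncomm_ring
    rw [e, ih, hHΛ, iterComm]
    simp only [smul_mul_assoc, mul_smul_comm]
    push_cast
    module

/-- The usual sl₂ computation for the adjoint action: `D` commutes with `L`, so it is a lowest
weight vector of weight -1, and `L` undoes one commutator with `Λ` up to a scalar. The scalar
vanishes at m = 1. -/
theorem raise_iterComm (hΛL : Λ * L - L * Λ = H) (hDL : D * L = L * D)
    (hHD : H * D - D * H = -D) (hHΛ : H * Λ - Λ * H = (2 : ℝ) • Λ) (m : ℕ) :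
    L * iterComm Λ D (m + 1) - iterComm Λ D (m + 1) * L =
      (-(m + 1) * (m - 1) : ℝ) • iterComm Λ D m := by
  induction m with
  | zero =>
    have e : L * iterComm Λ D 1 - iterComm Λ D 1 * L = -((Λ * L - L * Λ) * D - D * (Λ * L - L * Λ)) +
        (D * L - L * D) * Λ - Λ * (D * L - L * D) := by
      simp only [iterComm]
      noncomm_ring
    rw [e, hΛL, hHD, hDL]
    simp [iterComm]
  | succ m ih =>
    have hw := weight_iterComm (R := R) hHD hHΛ (m + 1)
    have e : L * iterComm Λ D (m + 2) - iterComm Λ D (m + 2) * L =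
        -((Λ * L - L * Λ) * iterComm Λ D (m + 1) - iterComm Λ D (m + 1) * (Λ * L - L * Λ)) +
        (Λ * (L * iterComm Λ D (m + 1) - iterComm Λ D (m + 1) * L) -
          (L * iterComm Λ D (m + 1) - iterComm Λ D (m + 1) * L) * Λ) := by
      rw [iterComm]
      noncomm_ring
    have e2 : (-(m + 1) * (m - 1) : ℝ) • (Λ * iterComm Λ D m - iterComm Λ D m * Λ) =
        (-(m + 1) * (m - 1) : ℝ) • iterComm Λ D (m + 1) := rfl
    rw [e, hΛL, hw, ih, mul_smul_comm, smul_mul_assoc, ← smul_sub, e2]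
    push_cast
    module

/-- A lowest weight vector of weight -1 whose tower of commutators ends generates a representation
of dimension at most two. Concretely, vanishing at m + 1 passes down to m whenever (m + 1)(m - 1) ≠
0, and this descent stops at 2. -/
theorem iterComm_two_eq_zero (hΛL : Λ * L - L * Λ = H) (hDL : D * L = L * D)
    (hHD : H * D - D * H = -D) (hHΛ : H * Λ - Λ * H = (2 : ℝ) • Λ) {N : ℕ} (hN : 2 ≤ N)
    (h : iterComm Λ D N = 0) : iterComm Λ D 2 = 0 := by
  induction N, hN using Nat.le_induction with
  | base => exact h
  | succ m hm ih =>
    refine ih ?_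
    have h1 := raise_iterComm hΛL hDL hHD hHΛ m
    rw [h, mul_zero, zero_mul, sub_zero, eq_comm, smul_eq_zero] at h1
    refine h1.resolve_left ?_
    have : (2 : ℝ) ≤ m := by exact_mod_cast hm
    nlinarith

end Commutators

namespace LefschetzAction

variable {n : ℕ} {G : ℕ → Type*} [∀ k, AddCommGroup (G k)] [∀ k, Module ℝ (G k)]
  (A : LefschetzAction n G)

open DirectSum

/-- The raising operator on the total space. -/
noncomputable def totalL : Module.End ℝ (⨁ k, G k) :=
  toModule ℝ ℕ _ fun k => lof ℝ ℕ G (k + 2) ∘ₗ A.L k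

/-- The lowering operator on the total space. -/
noncomputable def totalDual : Module.End ℝ (⨁ k, G k) :=
  toModule ℝ ℕ _ fun k => match k with
    | 0 => 0
    | 1 => 0
    | k + 2 => lof ℝ ℕ G k ∘ₗ A.dual k

variable (n G) in
/-- The weight operator on the total space. -/
noncomputable def totalWeight : Module.End ℝ (⨁ k, G k) :=
  toModule ℝ ℕ _ fun k => (n - k : ℝ) • lof ℝ ℕ G k

theorem totalL_lof (k : ℕ) (a : G k) :
    A.totalL (lof ℝ ℕ G k a) = lof ℝ ℕ G (k + 2) (A.L k a) := toModule_lof _ _ _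

theorem totalDual_lof_zero (a : G 0) : A.totalDual (lof ℝ ℕ G 0 a) = 0 := toModule_lof _ _ _

theorem totalDual_lof_one (a : G 1) : A.totalDual (lof ℝ ℕ G 1 a) = 0 := toModule_lof _ _ _

theorem totalDual_lof (k : ℕ) (a : G (k + 2)) :
    A.totalDual (lof ℝ ℕ G (k + 2) a) = lof ℝ ℕ G k (A.dual k a) := toModule_lof _ _ _

theorem totalWeight_lof (k : ℕ) (a : G k) :
    totalWeight n G (lof ℝ ℕ G k a) = (n - k : ℝ) • lof ℝ ℕ G k a := toModule_lof _ _ _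

theorem totalDual_totalL : A.totalDual * A.totalL - A.totalL * A.totalDual = totalWeight n G := by
  refine DirectSum.linearMap_ext ℝ fun k => LinearMap.ext fun a => ?_
  change A.totalDual (A.totalL (lof ℝ ℕ G k a)) - A.totalL (A.totalDual (lof ℝ ℕ G k a)) = _
  rw [LinearMap.comp_apply, totalWeight_lof, totalL_lof, totalDual_lof]
  match k with
  | 0 => rw [totalDual_lof_zero, A.dual_L_zero, map_zero, map_smul]; simp
  | 1 => rw [totalDual_lof_one, A.dual_L_one, map_zero, map_smul]; simp
  | k + 2 => rw [totalDual_lof, totalL_lof, A.dual_L, map_add, map_smul]; simp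

theorem totalWeight_totalDual :
    totalWeight n G * A.totalDual - A.totalDual * totalWeight n G = (2 : ℝ) • A.totalDual := by
  refine DirectSum.linearMap_ext ℝ fun k => LinearMap.ext fun a => ?_
  change totalWeight n G (A.totalDual (lof ℝ ℕ G k a)) -
    A.totalDual (totalWeight n G (lof ℝ ℕ G k a)) = (2 : ℝ) • A.totalDual (lof ℝ ℕ G k a)
  rw [totalWeight_lof, map_smul]
  match k with
  | 0 => rw [totalDual_lof_zero]; simp
  | 1 => rw [totalDual_lof_one]; simp
  | k + 2 =>
    rw [totalDual_lof, totalWeight_lof]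
    push_cast
    module

variable (d : ∀ k, G k →ₗ[ℝ] G (k + 1))

/-- An operator of degree one on the total space. -/
noncomputable def totalD : Module.End ℝ (⨁ k, G k) :=
  toModule ℝ ℕ _ fun k => lof ℝ ℕ G (k + 1) ∘ₗ d k

theorem totalD_lof (k : ℕ) (a : G k) :
    totalD d (lof ℝ ℕ G k a) = lof ℝ ℕ G (k + 1) (d k a) := toModule_lof _ _ _

theorem totalWeight_totalD :
    totalWeight n G * totalD d - totalD d * totalWeight n G = -totalD d := by
  refine DirectSum.linearMap_ext ℝ fun k => LinearMap.ext fun a => ?_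
  change totalWeight n G (totalD d (lof ℝ ℕ G k a)) -
    totalD d (totalWeight n G (lof ℝ ℕ G k a)) = -totalD d (lof ℝ ℕ G k a)
  rw [totalWeight_lof, map_smul, totalD_lof, totalWeight_lof]
  push_cast
  module

theorem totalD_totalL (hd : ∀ k a, d (k + 2) (A.L k a) = A.L (k + 1) (d k a)) :
    totalD d * A.totalL = A.totalL * totalD d := by
  refine DirectSum.linearMap_ext ℝ fun k => LinearMap.ext fun a => ?_
  change totalD d (A.totalL (lof ℝ ℕ G k a)) = A.totalL (totalD d (lof ℝ ℕ G k a))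
  rw [totalL_lof, totalD_lof, totalD_lof, totalL_lof, hd]

/-- Weight `w` means that the degree drops by `w`, which is more than any nonzero degree allows. -/
theorem eq_zero_of_weight {N : ℕ} (hN : ∀ k, N < k → ∀ a : G k, a = 0)
    (D : Module.End ℝ (⨁ k, G k)) {w : ℝ} (hw : (N : ℝ) < w)
    (h : totalWeight n G * D - D * totalWeight n G = w • D) : D = 0 := by
  refine DirectSum.linearMap_ext ℝ fun k => LinearMap.ext fun a => ?_
  rw [LinearMap.comp_apply, LinearMap.zero_comp, LinearMap.zero_apply]
  by_cases hk : N < k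
  · rw [hN k hk a, map_zero, map_zero]
  have h1 := LinearMap.congr_fun h (lof ℝ ℕ G k a)
  change totalWeight n G (D (lof ℝ ℕ G k a)) - D (totalWeight n G (lof ℝ ℕ G k a)) =
    w • D (lof ℝ ℕ G k a) at h1
  rw [totalWeight_lof, map_smul] at h1
  obtain ⟨y, hy⟩ : ∃ y, y = D (lof ℝ ℕ G k a) := ⟨_, rfl⟩
  rw [← hy] at h1 ⊢
  have hcomp : ∀ j, component ℝ ℕ G j (totalWeight n G y) = (n - j : ℝ) • component ℝ ℕ G j y := by
    intro j
    have : component ℝ ℕ G j ∘ₗ totalWeight n G = (n - j : ℝ) • component ℝ ℕ G j := by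
      refine DirectSum.linearMap_ext ℝ fun i => LinearMap.ext fun b => ?_
      rw [LinearMap.comp_apply, LinearMap.comp_apply, LinearMap.comp_apply, totalWeight_lof,
        map_smul, LinearMap.smul_apply]
      by_cases hij : i = j
      · subst hij
        rfl
      · rw [component.of, dif_neg hij, smul_zero, smul_zero]
    exact LinearMap.congr_fun this y
  refine DFinsupp.ext fun j => ?_
  have h2 := congrArg (component ℝ ℕ G j) h1
  rw [map_sub, hcomp, map_smul, map_smul, ← sub_smul, ← sub_eq_zero, ← sub_smul,
    smul_eq_zero] at h2
  refine h2.resolve_left ?_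
  have h3 : (k : ℝ) ≤ N := by exact_mod_cast not_lt.1 hk
  have h4 : (0 : ℝ) ≤ j := Nat.cast_nonneg j
  intro h5
  linarith

/-- If `η` is primitive and `d` commutes with `L`, then `Λ²dη = 0`. -/
theorem dual_dual_d {N : ℕ} (hN : ∀ k, N < k → ∀ a : G k, a = 0)
    (hd : ∀ k a, d (k + 2) (A.L k a) = A.L (k + 1) (d k a)) (k : ℕ) (a : G (k + 3))
    (ha : A.dual (k + 1) a = 0) : A.dual k (A.dual (k + 2) (d (k + 3) a)) = 0 := by
  have hHD := totalWeight_totalD (n := n) d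
  -- The weight is 2(N + 2) - 1, which exceeds the top degree `N`.
  have hvan : iterComm A.totalDual (totalD d) (N + 2) = 0 := by
    refine eq_zero_of_weight hN _ ?_ (weight_iterComm hHD A.totalWeight_totalDual (N + 2))
    push_cast
    linarith [(Nat.cast_nonneg N : (0 : ℝ) ≤ N)]
  have h2 := iterComm_two_eq_zero A.totalDual_totalL (A.totalD_totalL d hd) hHD
    A.totalWeight_totalDual (Nat.le_add_left 2 N) hvan
  have h3 := LinearMap.congr_fun h2 (lof ℝ ℕ G (k + 3) a)
  have h0 : A.totalDual (lof ℝ ℕ G (k + 3) a) = 0 := by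
    rw [A.totalDual_lof (k + 1), ha, map_zero]
  change A.totalDual (A.totalDual (totalD d (lof ℝ ℕ G (k + 3) a)) -
      totalD d (A.totalDual (lof ℝ ℕ G (k + 3) a))) -
    (A.totalDual (totalD d (A.totalDual (lof ℝ ℕ G (k + 3) a))) -
      totalD d (A.totalDual (A.totalDual (lof ℝ ℕ G (k + 3) a)))) = 0 at h3
  rw [h0, map_zero, map_zero, map_zero, sub_zero, sub_self, sub_zero, totalD_lof,
    A.totalDual_lof (k + 2), A.totalDual_lof k] at h3
  have h4 := congrArg (component ℝ ℕ G k) h3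
  rwa [component.lof_self, map_zero] at h4

end LefschetzAction

end SymplecticForms

namespace SymplecticForms

/-! ### Division by dρ along the boundary. -/

section Hamiltonian

variable {E : Type*} [NormedAddCommGroup E] [NormedSpace ℝ E]
  {H : Type*} [TopologicalSpace H] {I : ModelWithCorners ℝ E H}
  {M : Type*} [TopologicalSpace M] [ChartedSpace H M] [IsManifold I ∞ M] {k : ℕ}
  [FiniteDimensional ℝ E]

/-- A linear function of the chart coordinates, cut off by a bump function equal to 1 near `c`. -/
theorem exists_covec_eq [T2Space M] (c : M) (ℓ : E →L[ℝ] ℝ) :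
    ∃ g : C^∞⟮I, M; ℝ⟯, covec g c = ℓ := by
  obtain ⟨f⟩ : Nonempty (SmoothBumpFunction I c) := inferInstance
  have hg : ContMDiffOn I 𝓘(ℝ, ℝ) ∞ (fun x => ℓ (extChartAt I c x)) (chartAt H c).source :=
    ℓ.contMDiff.comp_contMDiffOn contMDiffOn_extChartAt
  refine ⟨⟨fun x => f x • ℓ (extChartAt I c x), f.contMDiff_smul hg⟩, ?_⟩
  have hev : (fun y => f ((extChartAt I c).symm y) • ℓ (extChartAt I c ((extChartAt I c).symm y)))
      =ᶠ[𝓝[range I] (extChartAt I c c)] ℓ := by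
    have h1 : ∀ᶠ y in 𝓝[range I] (extChartAt I c c), f ((extChartAt I c).symm y) = 1 := by
      have hc : Filter.Tendsto (extChartAt I c).symm (𝓝[range I] (extChartAt I c c)) (𝓝 c) := by
        have := (continuousAt_extChartAt_symm (I := I) c).tendsto
        rw [extChartAt_to_inv] at this
        exact this.mono_left nhdsWithin_le_nhds
      exact hc.eventually f.eventuallyEq_one
    filter_upwards [h1, extChartAt_target_mem_nhdsWithin (I := I) c] with y hy hyt
    rw [hy, (extChartAt I c).right_inv hyt, one_smul]
  have hu : UniqueDiffWithinAt ℝ (range I) (extChartAt I c c) :=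
    I.uniqueDiffOn _ (mem_range_self _)
  change fderivWithin ℝ (fun y => f ((extChartAt I c).symm y) •
    ℓ (extChartAt I c ((extChartAt I c).symm y))) (range I) (extChartAt I c c) = ℓ
  rw [hev.fderivWithin_eq_of_mem (mem_range_self _)]
  exact ℓ.fderivWithin hu

omit [IsManifold I ∞ M] [FiniteDimensional ℝ E] in
theorem covec_ne_zero (ρ : BoundaryDefiningFunction I M) {x : M} (hx : x ∈ I.boundary M) :
    covec ρ.fn x ≠ 0 := by
  have h := ρ.mfderiv_ne_zero x hx
  have hd : MDifferentiableAt I 𝓘(ℝ, ℝ) ρ.fn x := ρ.fn.contMDiff.mdifferentiableAt (by simp)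
  intro h0
  refine h ?_
  rw [hd.mfderiv]
  exact h0

theorem exists_poissonFn_ne_zero [T2Space M] (ω₀ : SymplecticForm I M)
    (ρ : BoundaryDefiningFunction I M) {x : M} (hx : x ∈ I.boundary M) :
    ∃ g : C^∞⟮I, M; ℝ⟯, poissonFn ω₀ ρ.fn g x ≠ 0 := by
  obtain ⟨u, hu⟩ : ∃ u, covec ρ.fn x u ≠ 0 := by
    by_contra! h
    exact covec_ne_zero ρ hx (ContinuousLinearMap.ext h)
  -- With dg = ω(·, u) at `x`, the Hamiltonian vector of `g` there is `u`, so the bracket with ρ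
  -- equals dρ(u) ≠ 0.
  obtain ⟨g, hg⟩ := exists_covec_eq (I := I) x ((bilinOfTwoForm (ω₀.form.1 x)).flip u)
  refine ⟨g, ?_⟩
  rw [poissonFn_apply, hamVec, hg]
  convert hu
  exact sharp_flip _ _ (ω₀.isUnit_det _ x) u

/-- If `dρ ∧ ξ = 0` along the boundary, then `ξ = dρ ∧ σ` along the boundary for a smooth `σ`. -/
theorem exists_wedgeOne_eq [T2Space M] [CompactSpace M] (ω₀ : SymplecticForm I M)
    (ρ : BoundaryDefiningFunction I M) (ξ : Form I M (k + 1))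
    (hξ : ∀ x ∈ I.boundary M, wedgeOne (covec ρ.fn x) (ξ.1 x) = 0) :
    ∃ σ : Form I M k, ∀ x ∈ I.boundary M, wedgeOne (covec ρ.fn x) (σ.1 x) = ξ.1 x := by
  choose! g hg using fun x (hx : x ∈ I.boundary M) => exists_poissonFn_ne_zero ω₀ ρ hx
  have hcpt : IsCompact (I.boundary M) := (I.isClosed_boundary (n := ∞) (by simp)).isCompact
  obtain ⟨t, -, ht⟩ := hcpt.elim_nhds_subcover (fun c => {x | poissonFn ω₀ ρ.fn (g c) x ≠ 0})
    fun c hc => (isOpen_ne.preimage (poissonFn ω₀ ρ.fn (g c)).contMDiff.continuous).mem_nhds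
      (hg c hc)
  -- Finitely many brackets have no common zero on the compact boundary, and ρ² > 0 in the interior.
  -- So `S` is invertible on all of M, and no partition of unity is needed.
  let S : C^∞⟮I, M; ℝ⟯ := ρ.fn * ρ.fn + ∑ c ∈ t, poissonFn ω₀ ρ.fn (g c) * poissonFn ω₀ ρ.fn (g c)
  have hSx : ∀ x, S x = ρ.fn x * ρ.fn x +
      ∑ c ∈ t, poissonFn ω₀ ρ.fn (g c) x * poissonFn ω₀ ρ.fn (g c) x := fun x => by
    let ev : C^∞⟮I, M; ℝ⟯ →+ ℝ :=
      { toFun := fun f => f x, map_zero' := rfl, map_add' := fun _ _ => rfl }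
    change ev (_ + ∑ c ∈ t, _) = _
    rw [map_add, map_sum]
    rfl
  have hS : ∀ x, S x ≠ 0 := fun x => by
    rw [hSx]
    have hsum : ∀ c ∈ t, 0 ≤ poissonFn ω₀ ρ.fn (g c) x * poissonFn ω₀ ρ.fn (g c) x :=
      fun c _ => mul_self_nonneg _
    rcases I.isInteriorPoint_or_isBoundaryPoint x with hx | hx
    · have h1 := ρ.neg_of_interior x hx
      have h2 := Finset.sum_nonneg hsum
      nlinarith
    · obtain ⟨c, hc, hcx⟩ := mem_iUnion₂.1 (ht hx)
      have h3 : 0 < poissonFn ω₀ ρ.fn (g c) x * poissonFn ω₀ ρ.fn (g c) x :=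
        mul_self_pos.2 hcx
      have h2 := Finset.sum_pos' hsum ⟨c, hc, h3⟩
      nlinarith [mul_self_nonneg (ρ.fn x)]
  let Sinv : C^∞⟮I, M; ℝ⟯ := ⟨fun x => (S x)⁻¹, S.contMDiff.inv₀ hS⟩
  -- Contracting dρ ∧ ξ = 0 with the Hamiltonian field X_g gives dρ ∧ i_{X_g}ξ = {ρ, g}ξ. Weighting
  -- by {ρ, g}/S makes the coefficients add up to 1 where ρ = 0.
  refine ⟨∑ c ∈ t, mulForm Sinv (mulForm (poissonFn ω₀ ρ.fn (g c)) (hamContract ω₀ (g c) k ξ)),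
    fun x hx => ?_⟩
  let ev : Form I M k →+ (E [⋀^Fin k]→L[ℝ] ℝ) :=
    { toFun := fun η => η.1 x, map_zero' := rfl, map_add' := fun _ _ => rfl }
  have h0 : ρ.fn x = 0 := ρ.eq_zero_of_boundary x hx
  change wedgeOne (covec ρ.fn x) (ev (∑ c ∈ t, _)) = _
  rw [map_sum, map_sum]
  have hterm : ∀ c ∈ t, wedgeOne (covec ρ.fn x) (ev (mulForm Sinv
      (mulForm (poissonFn ω₀ ρ.fn (g c)) (hamContract ω₀ (g c) k ξ)))) =
      ((S x)⁻¹ * (poissonFn ω₀ ρ.fn (g c) x * poissonFn ω₀ ρ.fn (g c) x)) • ξ.1 x := fun c _ => by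
    change wedgeOne (covec ρ.fn x) ((S x)⁻¹ • poissonFn ω₀ ρ.fn (g c) x •
      (hamContract ω₀ (g c) k ξ).1 x) = _
    have h1 := curryLeft_wedgeOne (covec ρ.fn x) (ξ.1 x) (hamVec ω₀ (g c) x)
    rw [hξ x hx, ContinuousAlternatingMap.curryLeft_zero, zero_apply, ← poissonFn_apply, eq_comm,
      sub_eq_zero] at h1
    rw [map_smul, map_smul, hamContract_apply]
    erw [← h1]
    rw [smul_smul, smul_smul, mul_assoc]
  rw [Finset.sum_congr rfl hterm, ← Finset.sum_smul, ← Finset.mul_sum]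
  have := hSx x
  rw [h0, mul_zero, zero_add] at this
  rw [← this, inv_mul_cancel₀ (hS x), one_smul]

end Hamiltonian

/-! ### First derivatives along the boundary in half-space charts. -/

section Boundary

variable {m : ℕ} [NeZero m] {M : Type*} [TopologicalSpace M]
  [ChartedSpace (EuclideanHalfSpace m) M] [IsManifold (𝓡∂ m) ∞ M] {k : ℕ}

theorem extChartAt_symm_mem_boundary {x : M} {y : EuclideanSpace ℝ (Fin m)}
    (hy : y ∈ (extChartAt (𝓡∂ m) x).target) (h0 : y 0 = 0) :
    (extChartAt (𝓡∂ m) x).symm y ∈ (𝓡∂ m).boundary M := by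
  have hz : (extChartAt (𝓡∂ m) x).symm y ∈ (chartAt (EuclideanHalfSpace m) x).source := by
    rw [← extChartAt_source (𝓡∂ m)]
    exact (extChartAt (𝓡∂ m) x).map_target hy
  refine ((𝓡∂ m).isBoundaryPoint_iff_of_mem_atlas (n := ∞) (by simp)
    (chart_mem_atlas _ x) hz).2 ?_
  change extChartAt (𝓡∂ m) x ((extChartAt (𝓡∂ m) x).symm y) ∈
    frontier (extChartAt (𝓡∂ m) x).target
  rw [(extChartAt (𝓡∂ m) x).right_inv hy]
  refine ⟨subset_closure hy, fun hi => ?_⟩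
  have h1 := interior_mono (extChartAt_target_subset_range (I := 𝓡∂ m) x) hi
  rw [interior_range_modelWithCornersEuclideanHalfSpace] at h1
  exact h1.ne' h0

omit [IsManifold (𝓡∂ m) ∞ M] in
-- A tangential vector is the velocity of a straight line in the boundary hyperplane of the chart,
-- and `F` vanishes on that line near the base point.
theorem fderivWithin_tangential {W : Type*} [NormedAddCommGroup W] [NormedSpace ℝ W] {x : M}
    (hx : x ∈ (𝓡∂ m).boundary M) {F : EuclideanSpace ℝ (Fin m) → W}
    (hF : DifferentiableWithinAt ℝ F (range (𝓡∂ m)) (extChartAt (𝓡∂ m) x x))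
    (hF0 : ∀ y ∈ (extChartAt (𝓡∂ m) x).target, y 0 = 0 → F y = 0)
    {v : EuclideanSpace ℝ (Fin m)} (hv : v 0 = 0) :
    fderivWithin ℝ F (range (𝓡∂ m)) (extChartAt (𝓡∂ m) x x) v = 0 := by
  obtain ⟨y₀, hy₀⟩ : ∃ y₀, y₀ = extChartAt (𝓡∂ m) x x := ⟨_, rfl⟩
  have h0 : y₀ 0 = 0 := by
    have h : extChartAt (𝓡∂ m) x x ∈ frontier (range (𝓡∂ m)) := hx
    rw [frontier_range_modelWithCornersEuclideanHalfSpace] at h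
    rw [hy₀]
    exact h.symm
  rw [← hy₀] at hF ⊢
  have hγ0 : ∀ t : ℝ, (y₀ + t • v) 0 = 0 := fun t => by simp [h0, hv]
  have hγr : ∀ t : ℝ, y₀ + t • v ∈ range (𝓡∂ m) := fun t => by
    rw [range_modelWithCornersEuclideanHalfSpace]
    exact (hγ0 t).ge
  have hγ : HasDerivAt (fun t : ℝ => y₀ + t • v) v 0 := by
    simpa using ((hasDerivAt_id (0 : ℝ)).smul_const v).const_add y₀
  have hF' : HasFDerivWithinAt F (fderivWithin ℝ F (range (𝓡∂ m)) y₀) (range (𝓡∂ m))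
      (y₀ + (0 : ℝ) • v) := by
    rw [zero_smul, add_zero]
    exact hF.hasFDerivWithinAt
  have h1 := hF'.comp_hasDerivAt (0 : ℝ) hγ (Filter.Eventually.of_forall hγr)
  have hev : (F ∘ fun t : ℝ => y₀ + t • v) =ᶠ[𝓝 0] fun _ => 0 := by
    have htend : Filter.Tendsto (fun t : ℝ => y₀ + t • v) (𝓝 0) (𝓝[range (𝓡∂ m)] y₀) := by
      refine tendsto_nhdsWithin_iff.2 ⟨?_, Filter.Eventually.of_forall hγr⟩
      have := hγ.continuousAt.tendsto
      rwa [zero_smul, add_zero] at this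
    have hmem := extChartAt_target_mem_nhdsWithin (I := 𝓡∂ m) x
    rw [← hy₀] at hmem
    filter_upwards [htend.eventually hmem] with t ht
    exact hF0 _ ht (hγ0 t)
  exact h1.unique ((hasDerivAt_const (0 : ℝ) (0 : W)).congr_of_eventuallyEq hev)

/-- If `θ` vanishes along the boundary, then so does `dρ ∧ dθ`. -/
theorem wedgeOne_covec_d_of_vanishing (ρ : BoundaryDefiningFunction (𝓡∂ m) M)
    (θ : Form (𝓡∂ m) M k) (hθ : ∀ x ∈ (𝓡∂ m).boundary M, θ.1 x = 0) {x : M}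
    (hx : x ∈ (𝓡∂ m).boundary M) : wedgeOne (covec ρ.fn x) ((d θ).1 x) = 0 := by
  obtain ⟨r, hr⟩ : ∃ r, r = covec ρ.fn x := ⟨_, rfl⟩
  obtain ⟨D, hD⟩ : ∃ D, D = fderivWithin ℝ (inChart (𝓡∂ m) θ.1 x) (range (𝓡∂ m))
    (extChartAt (𝓡∂ m) x x) := ⟨_, rfl⟩
  have hrt : ∀ v : EuclideanSpace ℝ (Fin m), v 0 = 0 → r v = 0 := fun v hv => by
    rw [hr]
    exact fderivWithin_tangential hx
      ((contDiffWithinAt_inChart_fn ρ.fn x).differentiableWithinAt (by simp))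
      (fun y hy h0 => ρ.eq_zero_of_boundary _ (extChartAt_symm_mem_boundary hy h0)) hv
  have hDt : ∀ v : EuclideanSpace ℝ (Fin m), v 0 = 0 → D v = 0 := fun v hv => by
    rw [hD]
    refine fderivWithin_tangential hx
      (form_differentiableWithinAt θ (mem_extChartAt_target x)) (fun y hy h0 => ?_) hv
    rw [inChart, hθ _ (extChartAt_symm_mem_boundary hy h0)]
    rfl
  obtain ⟨e, he⟩ : ∃ e : EuclideanSpace ℝ (Fin m), e = EuclideanSpace.single 0 1 := ⟨_, rfl⟩
  have hv : ∀ v : EuclideanSpace ℝ (Fin m), (v - v 0 • e) 0 = 0 := fun v => by simp [he]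
  have hrv : ∀ v, r v = v 0 * r e := fun v => by
    have := hrt _ (hv v)
    rwa [map_sub, map_smul, sub_eq_zero, smul_eq_mul] at this
  have hDv : ∀ v, D v = v 0 • D e := fun v => by
    have := hDt _ (hv v)
    rwa [map_sub, map_smul, sub_eq_zero] at this
  have hre : r e ≠ 0 := fun h => covec_ne_zero ρ hx (ContinuousLinearMap.ext fun v => by
    rw [← hr, hrv, h, mul_zero]
    rfl)
  -- Both derivatives kill the boundary hyperplane and `r` is nonzero, so D = r ⊗ β. Alternating
  -- gives dθ = dρ ∧ β at `x`.
  have hDr : D = r.smulRight ((r e)⁻¹ • D e) := by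
    ext1 v
    rw [ContinuousLinearMap.smulRight_apply, smul_smul, hDv v, hrv v, mul_assoc,
      mul_inv_cancel₀ hre, mul_one]
  have hd : (d θ).1 x = wedgeOne r ((r e)⁻¹ • D e) := by
    rw [wedgeOne_def, ← hDr, hD]
    rfl
  rw [← hr, hd, wedgeOne_self_wedgeOne]

end Boundary

end SymplecticForms

namespace SymplecticForms

/-! ### Lefschetz decomposition of smooth forms, and ∂₊ as d modulo the image of L. -/

section Lefschetz

variable {E : Type*} [NormedAddCommGroup E] [NormedSpace ℝ E] [FiniteDimensional ℝ E]
  {H : Type*} [TopologicalSpace H] {I : ModelWithCorners ℝ E H}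
  {M : Type*} [TopologicalSpace M] [ChartedSpace H M] [IsManifold I ∞ M] {k n : ℕ}

/-- The Lefschetz action of a symplectic form on the exterior algebra at a point. -/
noncomputable def pointAction (hn : Module.finrank ℝ E = 2 * n) (ω₀ : SymplecticForm I M) (x : M) :
    LefschetzAction n fun k => E [⋀^Fin k]→L[ℝ] ℝ where
  L k := { toFun := wedgeTwo (ω₀.form.1 x)
           map_add' := wedgeTwo_add _
           map_smul' := wedgeTwo_smul _ }
  dual k := lefschetzDual (Module.finBasis ℝ E) (ω₀.form.1 x)
  dual_L_zero a := by
    rw [← card_div_two hn]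
    exact lefschetzDual_wedgeTwo_fin_zero _ _ (ω₀.isUnit_det _ x) a
  dual_L_one a := by
    rw [← card_div_two hn]
    exact lefschetzDual_wedgeTwo_fin_one _ _ (ω₀.isUnit_det _ x) a
  dual_L k a := by
    rw [← card_div_two hn]
    exact lefschetzDual_wedgeTwo _ _ (ω₀.isUnit_det _ x) a

/-- The Lefschetz action of a symplectic form on smooth forms. -/
noncomputable def formAction (hn : Module.finrank ℝ E = 2 * n) (ω₀ : SymplecticForm I M) :
    LefschetzAction n fun k => Form I M k where
  L _ := wedge ω₀.form
  dual _ := dualForm ω₀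
  dual_L_zero a := Form.ext fun x => (pointAction hn ω₀ x).dual_L_zero (a.1 x)
  dual_L_one a := Form.ext fun x => (pointAction hn ω₀ x).dual_L_one (a.1 x)
  dual_L k a := Form.ext fun x => (pointAction hn ω₀ x).dual_L k (a.1 x)

theorem mem_primitive_add_two (ω₀ : SymplecticForm I M) {η : Form I M (k + 2)} :
    η ∈ primitive ω₀ (k + 2) ↔ dualForm ω₀ η = 0 :=
  ⟨fun h => Form.ext h, fun h x => congrFun (congrArg Subtype.val h) x⟩

theorem mulForm_mem_primitive (ω₀ : SymplecticForm I M) (f : C^∞⟮I, M; ℝ⟯) :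
    ∀ {k : ℕ} {η : Form I M k}, η ∈ primitive ω₀ k → mulForm f η ∈ primitive ω₀ k
  | 0, _, _ => trivial
  | 1, _, _ => trivial
  | k + 2, η, h => fun x => by
    rw [mulForm_apply, map_smul, h x, smul_zero]

/-- The image of the Lefschetz operator in `Ω^k`; zero for `k = 0, 1`. -/
noncomputable def lefschetzImage (ω₀ : SymplecticForm I M) : (k : ℕ) → Submodule ℝ (Form I M k)
  | 0 => ⊥
  | 1 => ⊥
  | _ + 2 => LinearMap.range (wedge ω₀.form)

omit [FiniteDimensional ℝ E] in
theorem d_mem_lefschetzImage (ω₀ : SymplecticForm I M) :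
    ∀ {k : ℕ} {η : Form I M k}, η ∈ lefschetzImage ω₀ k → d η ∈ lefschetzImage ω₀ (k + 1)
  | 0, η, h => by
    rw [(Submodule.mem_bot ℝ).1 h, map_zero]
    exact zero_mem _
  | 1, η, h => by
    rw [(Submodule.mem_bot ℝ).1 h, map_zero]
    exact zero_mem _
  | k + 2, η, h => by
    obtain ⟨σ, rfl⟩ := h
    exact ⟨d σ, (d_wedge _ ω₀.closed σ).symm⟩

omit [FiniteDimensional ℝ E] in
theorem mulForm_mem_lefschetzImage (ω₀ : SymplecticForm I M) (f : C^∞⟮I, M; ℝ⟯) :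
    ∀ {k : ℕ} {η : Form I M k}, η ∈ lefschetzImage ω₀ k → mulForm f η ∈ lefschetzImage ω₀ k
  | 0, η, h => by
    rw [(Submodule.mem_bot ℝ).1 h, map_zero]
    exact zero_mem _
  | 1, η, h => by
    rw [(Submodule.mem_bot ℝ).1 h, map_zero]
    exact zero_mem _
  | k + 2, η, h => by
    obtain ⟨σ, rfl⟩ := h
    exact ⟨mulForm f σ, (mulForm_wedge _ f σ).symm⟩

section

variable (hn : Module.finrank ℝ E = 2 * n) (ω₀ : SymplecticForm I M)
include hn

theorem wedge_injective (hk : k < n) {η : Form I M k} (h : wedge ω₀.form η = 0) : η = 0 :=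
  (formAction hn ω₀).L_injective hk h

theorem wedgeTwo_injective (x : M) (hk : k < n) {η : E [⋀^Fin k]→L[ℝ] ℝ}
    (h : wedgeTwo (ω₀.form.1 x) η = 0) : η = 0 :=
  (pointAction hn ω₀ x).L_injective hk h

/-- In degree k ≥ 2, ΛL is bijective on Ω^{k-2}: injectivity makes the intersection trivial, and
surjectivity splits every form. -/
theorem isCompl_primitive : ∀ {k : ℕ}, k ≤ n → IsCompl (primitive ω₀ k) (lefschetzImage ω₀ k)
  | 0, _ => isCompl_top_bot
  | 1, _ => isCompl_top_bot
  | k + 2, hk => by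
    refine IsCompl.of_le ?_ ?_
    · rintro η ⟨h1, σ, rfl⟩
      have h2 := (mem_primitive_add_two ω₀).1 h1
      rw [(formAction hn ω₀).eq_zero_of_dual_L (by omega : k < n) h2, map_zero]
      exact zero_mem _
    · intro η _
      obtain ⟨σ, hσ⟩ := (formAction hn ω₀).exists_dual_sub_L (by omega : k < n) η
      rw [← sub_add_cancel η (wedge ω₀.form σ)]
      exact Submodule.add_mem_sup ((mem_primitive_add_two ω₀).2 hσ) ⟨σ, rfl⟩

theorem exists_primitive_projection (hk : k ≤ n) : ∃ π : Form I M k →ₗ[ℝ] Form I M k,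
    (∀ α, π α ∈ primitive ω₀ k ∧ α - π α ∈ lefschetzImage ω₀ k) ∧
    ∀ α p, p ∈ primitive ω₀ k → α - p ∈ lefschetzImage ω₀ k → π α = p := by
  have hc := isCompl_primitive hn ω₀ hk
  refine ⟨(primitive ω₀ k).projection _ hc, fun α => ⟨Submodule.projection_apply_mem hc α,
    Submodule.sub_projection_mem hc α⟩, fun α p hp h => ?_⟩
  rw [← sub_add_cancel α p, map_add, (Submodule.projection_apply_eq_zero_iff hc).2 h, zero_add,
    Submodule.projection_apply_of_mem_left hc hp]

/-- Primitivity of ξ in dη = ζ + ω ∧ ξ is automatic, so ∂₊η is simply the primitive representative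
of dη modulo the image of L. Degree considerations suffice for η of degree at most 2; beyond that
Λ²dη = 0 is needed. -/
theorem mem_delPlus_iff : ∀ {k : ℕ}, k < n → ∀ {η : Form I M k} {ζ : Form I M (k + 1)},
    (η, ζ) ∈ delPlus ω₀ k ↔ η ∈ primitive ω₀ k ∧ ζ ∈ primitive ω₀ (k + 1) ∧
      d η - ζ ∈ lefschetzImage ω₀ (k + 1)
  | 0, _, η, ζ => Iff.rfl
  | 1, _, η, ζ => by
    have : wedgePrimitive ω₀ 1 = lefschetzImage ω₀ 2 := Submodule.map_top _
    rw [← this]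
    exact Iff.rfl
  | 2, _, η, ζ => by
    have : wedgePrimitive ω₀ 2 = lefschetzImage ω₀ 3 := Submodule.map_top _
    rw [← this]
    exact Iff.rfl
  | k + 3, hk, η, ζ => by
    refine and_congr_right fun hη => and_congr_right fun hζ => ?_
    refine ⟨fun ⟨ξ, _, h⟩ => ⟨ξ, h⟩, fun ⟨ξ, h⟩ => ⟨ξ, ?_, h⟩⟩
    have hη' := (mem_primitive_add_two ω₀).1 hη
    have hζ' := (mem_primitive_add_two ω₀).1 hζ
    have hdd := (formAction hn ω₀).dual_dual_d (fun _ => d) (N := 2 * n)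
      (fun k hk a => Form.ext fun x => eq_zero_of_finrank_lt (hn ▸ hk) _) (fun k a => d_wedge _ ω₀.closed a) k η hη'
    have h1 : d η = ζ + wedge ω₀.form ξ := by rw [h, add_sub_cancel]
    change dualForm ω₀ (dualForm ω₀ (d η)) = 0 at hdd
    rw [h1, map_add, hζ', zero_add] at hdd
    have h2 : dualForm ω₀ (wedge ω₀.form ξ) =
        wedge ω₀.form (dualForm ω₀ ξ) + (n - (k + 2 : ℕ) : ℝ) • ξ :=
      (formAction hn ω₀).dual_L k ξ
    -- Λ²dη = 0 has become (ΛL + (n - k - 2))(Λξ) = 0, and this forces Λξ = 0.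
    rw [h2, map_add, map_smul] at hdd
    have h3 : ((k + 2 : ℕ) : ℝ) ≤ n := by exact_mod_cast (by omega : k + 2 ≤ n)
    exact (mem_primitive_add_two ω₀).2 ((formAction hn ω₀).eq_zero_of_dual_L_add_smul k (by omega)
      (n - (k + 2 : ℕ)) (by linarith) _ hdd)

end

end Lefschetz

/-! ### Comparison of the two Dirichlet conditions. -/

section DirichletForms

variable {m : ℕ} [NeZero m] {M : Type*} [TopologicalSpace M] [T2Space M] [CompactSpace M]
  [ChartedSpace (EuclideanHalfSpace m) M] [IsManifold (𝓡∂ m) ∞ M] {k n : ℕ}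
  (ω₀ : SymplecticForm (𝓡∂ m) M) (ρ : BoundaryDefiningFunction (𝓡∂ m) M)

omit [T2Space M] [CompactSpace M] in
theorem d_mulForm_boundary (η : Form (𝓡∂ m) M k) {x : M} (hx : x ∈ (𝓡∂ m).boundary M) :
    (d (mulForm ρ.fn η)).1 x = wedgeOne (covec ρ.fn x) (η.1 x) := by
  have h0 : ρ.fn x = 0 := ρ.eq_zero_of_boundary x hx
  rw [d_mulForm_apply, h0, zero_smul, add_zero]

omit [T2Space M] [CompactSpace M] in
theorem mem_dirichlet_iff {η : Form (𝓡∂ m) M k} : η ∈ dirichlet ρ k ↔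
    ∀ x ∈ (𝓡∂ m).boundary M, wedgeOne (covec ρ.fn x) (η.1 x) = 0 :=
  forall₂_congr fun x hx => by rw [d_mulForm_boundary ρ η hx]

omit [T2Space M] [CompactSpace M] [NeZero m] [IsManifold (𝓡∂ m) ∞ M] in
theorem eq_zero_of_wedgeOne_fin_zero {V : Type*} [NormedAddCommGroup V] [NormedSpace ℝ V]
    {α : V →L[ℝ] ℝ} (hα : α ≠ 0) {η : V [⋀^Fin 0]→L[ℝ] ℝ} (h : wedgeOne α η = 0) : η = 0 := by
  obtain ⟨v, hv⟩ : ∃ v, α v ≠ 0 := by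
    by_contra! h0
    exact hα (ContinuousLinearMap.ext h0)
  have h1 := wedgeOne_fin_zero α η v
  rw [h, ContinuousAlternatingMap.curryLeft_zero, zero_apply, eq_comm, smul_eq_zero] at h1
  exact h1.resolve_left hv

include ω₀ in
-- Along the boundary η = dρ ∧ σ = d(ρσ) for some smooth σ. So η - d(ρσ) vanishes there, and dρ ∧ d
-- of it, which is dρ ∧ dη, vanishes too. In degree 0 the form η itself vanishes on the boundary.
theorem d_mem_dirichlet : ∀ {k : ℕ} {η : Form (𝓡∂ m) M k}, η ∈ dirichlet ρ k →
    d η ∈ dirichlet ρ (k + 1)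
  | 0, η, h => (mem_dirichlet_iff ρ).2 fun x hx =>
    wedgeOne_covec_d_of_vanishing ρ η (fun y hy => eq_zero_of_wedgeOne_fin_zero
      (covec_ne_zero ρ hy) ((mem_dirichlet_iff ρ).1 h y hy)) hx
  | k + 1, η, h => by
    obtain ⟨σ, hσ⟩ := exists_wedgeOne_eq ω₀ ρ η ((mem_dirichlet_iff ρ).1 h)
    refine (mem_dirichlet_iff ρ).2 fun x hx => ?_
    have h1 := wedgeOne_covec_d_of_vanishing ρ (η - d (mulForm ρ.fn σ)) (fun y hy => by
      rw [Form.sub_apply, d_mulForm_boundary ρ σ hy, hσ y hy, sub_self]) hx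
    rwa [map_sub, d_d, sub_zero] at h1

/-- The image of the Dirichlet forms under the Lefschetz operator in `Ω^k`. -/
noncomputable def lefschetzDirichlet : (k : ℕ) → Submodule ℝ (Form (𝓡∂ m) M k)
  | 0 => ⊥
  | 1 => ⊥
  | k + 2 => (dirichlet ρ k).map (wedge ω₀.form)

omit [T2Space M] [CompactSpace M] in
theorem lefschetzDirichlet_le_lefschetzImage :
    ∀ k, lefschetzDirichlet ω₀ ρ k ≤ lefschetzImage ω₀ k
  | 0 => le_rfl
  | 1 => le_rfl
  | _ + 2 => LinearMap.map_le_range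

theorem relCoboundaries_le_relCocycles (ω₀ : SymplecticForm (𝓡∂ m) M) :
    ∀ k, relCoboundaries ρ k ≤ relCocycles ρ k
  | 0 => bot_le
  | k + 1 => by
    rintro _ ⟨φ, hφ, rfl⟩
    exact ⟨d_d φ, d_mem_dirichlet ω₀ ρ hφ⟩

variable (hn : Module.finrank ℝ (EuclideanSpace ℝ (Fin m)) = 2 * n)
include hn

omit [T2Space M] [CompactSpace M] in
-- L commutes with dρ ∧ · and is injective on dρ ∧ σ, whose degree k + 1 is below n.
theorem mem_dirichlet_of_wedge (hk : k + 1 < n) {σ : Form (𝓡∂ m) M k}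
    (h : wedge ω₀.form σ ∈ dirichlet ρ (k + 2)) : σ ∈ dirichlet ρ k := by
  refine (mem_dirichlet_iff ρ).2 fun x hx => ?_
  have h1 := (mem_dirichlet_iff ρ).1 h x hx
  rw [wedge_apply, wedgeOne_wedgeTwo] at h1
  exact wedgeTwo_injective hn ω₀ x hk h1

omit [T2Space M] [CompactSpace M] in
theorem mem_lefschetzDirichlet : ∀ {k : ℕ}, k ≤ n → ∀ {l : Form (𝓡∂ m) M k},
    l ∈ lefschetzImage ω₀ k → l ∈ dirichlet ρ k → l ∈ lefschetzDirichlet ω₀ ρ k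
  | 0, _, _, h, _ => h
  | 1, _, _, h, _ => h
  | k + 2, hk, l, h, h' => by
    obtain ⟨σ, rfl⟩ := h
    exact ⟨σ, mem_dirichlet_of_wedge ω₀ ρ hn (by omega) h', rfl⟩

/-- Writing d(ρη) = ζ + ω ∧ ξ with ζ = 0 on the boundary gives ω ∧ ξ = dρ ∧ η there. Wedging with dρ
and cancelling L yields dρ ∧ ξ = 0, so ξ = dρ ∧ σ on the boundary. Then η - ω ∧ σ satisfies the
Dirichlet condition. -/
theorem exists_add_mem_dirichlet : ∀ {k : ℕ}, k < n → ∀ {η : Form (𝓡∂ m) M k},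
    η ∈ primitiveDPlus ω₀ ρ k → ∃ l ∈ lefschetzImage ω₀ k, η + l ∈ dirichlet ρ k
  | 0, hk, η, ⟨_, ζ, hζ, hζ0⟩ => by
    refine ⟨0, zero_mem _, ?_⟩
    rw [add_zero]
    intro x hx
    have h1 := (Submodule.mem_bot ℝ).1 ((mem_delPlus_iff hn ω₀ hk).1 hζ).2.2
    rw [sub_eq_zero.1 h1, hζ0 x hx]
  -- Here ξ is a function, so dρ ∧ ξ = 0 forces ξ = 0 on the boundary, and no correction is needed.
  | 1, hk, η, ⟨_, ζ, hζ, hζ0⟩ => by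
    refine ⟨0, zero_mem _, ?_⟩
    rw [add_zero]
    refine (mem_dirichlet_iff ρ).2 fun x hx => ?_
    obtain ⟨ξ, hξ⟩ := ((mem_delPlus_iff hn ω₀ hk).1 hζ).2.2
    have h1 : wedgeTwo (ω₀.form.1 x) (ξ.1 x) = wedgeOne (covec ρ.fn x) (η.1 x) := by
      rw [← wedge_apply, hξ, Form.sub_apply, hζ0 x hx, sub_zero, d_mulForm_boundary ρ η hx]
    have h2 : wedgeTwo (ω₀.form.1 x) (wedgeOne (covec ρ.fn x) (ξ.1 x)) = 0 := by
      rw [← wedgeOne_wedgeTwo, h1, wedgeOne_self_wedgeOne]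
    have h3 := eq_zero_of_wedgeOne_fin_zero (covec_ne_zero ρ hx)
      (wedgeTwo_injective hn ω₀ x hk h2)
    have h4 : (wedge ω₀.form (0 : Form (𝓡∂ m) M 0)).1 x = 0 := by rw [map_zero, Form.zero_apply]
    rw [← h1, h3]
    exact h4
  | k + 2, hk, η, ⟨_, ζ, hζ, hζ0⟩ => by
    obtain ⟨ξ, hξ⟩ := ((mem_delPlus_iff hn ω₀ hk).1 hζ).2.2
    have h1 : ∀ x ∈ (𝓡∂ m).boundary M,
        wedgeTwo (ω₀.form.1 x) (ξ.1 x) = wedgeOne (covec ρ.fn x) (η.1 x) := fun x hx => by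
      rw [← wedge_apply, hξ, Form.sub_apply, hζ0 x hx, sub_zero, d_mulForm_boundary ρ η hx]
    obtain ⟨σ, hσ⟩ := exists_wedgeOne_eq ω₀ ρ ξ fun x hx => by
      have h2 : wedgeTwo (ω₀.form.1 x) (wedgeOne (covec ρ.fn x) (ξ.1 x)) = 0 := by
        rw [← wedgeOne_wedgeTwo, h1 x hx, wedgeOne_self_wedgeOne]
      exact wedgeTwo_injective hn ω₀ x hk h2
    refine ⟨-wedge ω₀.form σ, neg_mem ⟨σ, rfl⟩, (mem_dirichlet_iff ρ).2 fun x hx => ?_⟩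
    rw [← sub_eq_add_neg, Form.sub_apply, map_sub, wedge_apply, wedgeOne_wedgeTwo, hσ x hx,
      h1 x hx, sub_self]

omit [T2Space M] [CompactSpace M] in
-- Modulo the image of L, the primitive part ζ of d(ρη) equals d(ρ(η + l)), which vanishes on the
-- boundary. At a boundary point ζ is therefore both primitive and in the image of L, hence zero.
theorem mem_primitiveDPlus (hk : k < n) {η l : Form (𝓡∂ m) M k} (hη : η ∈ primitive ω₀ k)
    (hl : l ∈ lefschetzImage ω₀ k) (h : η + l ∈ dirichlet ρ k) : η ∈ primitiveDPlus ω₀ ρ k := by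
  obtain ⟨π, hπ, -⟩ := exists_primitive_projection hn ω₀ (k := k + 1) hk
  obtain ⟨h1, h2⟩ := hπ (d (mulForm ρ.fn η))
  refine ⟨hη, _, (mem_delPlus_iff hn ω₀ hk).2 ⟨mulForm_mem_primitive ω₀ _ hη, h1, h2⟩,
    fun x hx => ?_⟩
  obtain ⟨ζ, hζ⟩ : ∃ ζ, ζ = π (d (mulForm ρ.fn η)) := ⟨_, rfl⟩
  rw [← hζ] at h1 h2 ⊢
  have h3 : ζ - d (mulForm ρ.fn (η + l)) ∈ lefschetzImage ω₀ (k + 1) := by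
    have h4 := neg_mem (add_mem h2 (d_mem_lefschetzImage ω₀
      (mulForm_mem_lefschetzImage ω₀ ρ.fn hl)))
    rw [map_add, map_add]
    convert h4 using 1
    abel
  have h5 : (d (mulForm ρ.fn (η + l))).1 x = 0 := h x hx
  have h6 : (ζ - d (mulForm ρ.fn (η + l))).1 x = ζ.1 x := by rw [Form.sub_apply, h5, sub_zero]
  rw [← h6]
  cases k with
  | zero =>
    rw [(Submodule.mem_bot ℝ).1 h3]
    rfl
  | succ j =>
    obtain ⟨τ, hτ⟩ := h3
    rw [← hτ, wedge_apply] at h6 ⊢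
    have h7 : lefschetzDual (Module.finBasis ℝ _) (ω₀.form.1 x) (ζ.1 x) = 0 := h1 x
    rw [← h6] at h7
    rw [(pointAction hn ω₀ x).eq_zero_of_dual_L (by omega : j < n) h7]
    exact map_zero ((pointAction hn ω₀ x).L j)

end DirichletForms

end SymplecticForms

/-! ### The exact sequence in cohomology and its splitting. -/

namespace SymplecticForms

/-- If `X = Z / ker p`, `Y = Z / ker q` and `W = R / ker r`, with `ker q / ker p = R / ker r`, then
`X ≃ Y × W`. -/
theorem nonempty_equiv_prod {Z R X Y W : Type*} [AddCommGroup Z] [Module ℝ Z] [AddCommGroup R]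
    [Module ℝ R] [AddCommGroup X] [Module ℝ X] [AddCommGroup Y] [Module ℝ Y] [AddCommGroup W]
    [Module ℝ W] (p : Z →ₗ[ℝ] X) (q : Z →ₗ[ℝ] Y) (r : R →ₗ[ℝ] W) (j : R →ₗ[ℝ] Z)
    (hp : Function.Surjective p) (hq : Function.Surjective q) (hr : Function.Surjective r)
    (hpq : ∀ z, p z = 0 → q z = 0) (hqj : ∀ x, q (j x) = 0)
    (hex : ∀ z, q z = 0 → ∃ x, p z = p (j x)) (hrj : ∀ x, r x = 0 ↔ p (j x) = 0) :
    Nonempty (X ≃ₗ[ℝ] Y × W) := by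
  obtain ⟨s, hs⟩ := LinearMap.exists_rightInverse_of_surjective p (LinearMap.range_eq_top.2 hp)
  obtain ⟨t, ht⟩ := LinearMap.exists_rightInverse_of_surjective q (LinearMap.range_eq_top.2 hq)
  obtain ⟨u, hu⟩ := LinearMap.exists_rightInverse_of_surjective r (LinearMap.range_eq_top.2 hr)
  have hs' : ∀ x, p (s x) = x := LinearMap.congr_fun hs
  have ht' : ∀ y, q (t y) = y := LinearMap.congr_fun ht
  have hu' : ∀ w, r (u w) = w := LinearMap.congr_fun hu
  -- The inverse isomorphism: lift the `Y` component through a section of `q`, the `W` component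
  -- through a section of `r`, and add their images in `X`.
  let f : Y × W →ₗ[ℝ] X := (p ∘ₗ t).coprod (p ∘ₗ j ∘ₗ u)
  have hf : ∀ y w, f (y, w) = p (t y + j (u w)) := fun y w => (map_add p _ _).symm
  refine ⟨(LinearEquiv.ofBijective f ⟨?_, ?_⟩).symm⟩
  · rw [injective_iff_map_eq_zero]
    rintro ⟨y, w⟩ h
    rw [hf] at h
    have h1 := hpq _ h
    rw [map_add, hqj, add_zero, ht'] at h1
    subst h1
    rw [map_zero, zero_add, ← hrj, hu'] at h
    rw [h]
    rfl
  · intro x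
    obtain ⟨x', hx'⟩ := hex (s x - t (q (s x))) (by rw [map_sub, ht', sub_self])
    refine ⟨(q (s x), r x'), ?_⟩
    have h1 : p (j (u (r x') - x')) = 0 := (hrj _).1 (by rw [map_sub, hu', sub_self])
    rw [map_sub, map_sub, sub_eq_zero] at h1
    rw [hf, map_add, h1, ← hx', ← map_add, add_sub_cancel, hs']

section Cohomology

variable {m : ℕ} [NeZero m] {M : Type*} [TopologicalSpace M] [T2Space M] [CompactSpace M]
  [ChartedSpace (EuclideanHalfSpace m) M] [IsManifold (𝓡∂ m) ∞ M] {k n : ℕ}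
  (ω₀ : SymplecticForm (𝓡∂ m) M) (ρ : BoundaryDefiningFunction (𝓡∂ m) M)

/-- The Dirichlet forms that are closed modulo the image of the Lefschetz operator. -/
noncomputable def lefschetzCocycles (k : ℕ) : Submodule ℝ (Form (𝓡∂ m) M k) :=
  dirichlet ρ k ⊓ (lefschetzImage ω₀ (k + 1)).comap d

omit [T2Space M] [CompactSpace M] in
theorem relCocycles_le_lefschetzCocycles : relCocycles ρ k ≤ lefschetzCocycles ω₀ ρ k :=
  fun η hη => ⟨hη.2, by
    change d η ∈ lefschetzImage ω₀ (k + 1)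
    rw [LinearMap.mem_ker.1 hη.1]
    exact zero_mem _⟩

variable (hn : Module.finrank ℝ (EuclideanSpace ℝ (Fin m)) = 2 * n)
include hn

omit [T2Space M] [CompactSpace M] in
theorem mem_primCocycles_iff (hk : k < n) {η : Form (𝓡∂ m) M k} : η ∈ primCocycles ω₀ ρ k ↔
    η ∈ primitiveDPlus ω₀ ρ k ∧ d η ∈ lefschetzImage ω₀ (k + 1) := by
  refine and_congr_right fun h => ?_
  change (η, (0 : Form (𝓡∂ m) M (k + 1))) ∈ delPlus ω₀ k ↔ _
  refine (mem_delPlus_iff hn ω₀ hk).trans ⟨fun h1 => ?_, fun h1 => ⟨h.1, zero_mem _, ?_⟩⟩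
  · simpa using h1.2.2
  · simpa using h1

/-- If p = ∂₊φ, correct φ by l in the image of L so that φ + l is Dirichlet. Then α - d(φ + l) is
Dirichlet and in the image of L, hence in LΩ_D. Conversely, if α is dφ plus an element of LΩ_D, then
the primitive part of φ has ∂₊ equal to p. -/
theorem mem_primCoboundaries_iff : ∀ {k : ℕ}, k < n → ∀ {α p : Form (𝓡∂ m) M k},
    α ∈ dirichlet ρ k → p ∈ primitive ω₀ k → α - p ∈ lefschetzImage ω₀ k →
    (p ∈ primCoboundaries ω₀ ρ k ↔ α ∈ relCoboundaries ρ k ⊔ lefschetzDirichlet ω₀ ρ k)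
  | 0, _, α, p, _, _, h => by
    rw [sub_eq_zero.1 ((Submodule.mem_bot ℝ).1 h)]
    change p ∈ (⊥ : Submodule ℝ _) ↔ p ∈ (⊥ : Submodule ℝ _) ⊔ ⊥
    rw [bot_sup_eq]
  | k + 1, hk, α, p, hα, hp, h => by
    constructor
    · rintro ⟨⟨φ, ζ⟩, ⟨h1, h2⟩, h3⟩
      change ζ = p at h3
      subst h3
      obtain ⟨-, -, h4⟩ := (mem_delPlus_iff hn ω₀ (by omega)).1 h1
      obtain ⟨l, hl, h5⟩ := exists_add_mem_dirichlet ω₀ ρ hn (by omega) h2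
      refine Submodule.mem_sup.2 ⟨d (φ + l), ⟨_, h5, rfl⟩, α - d (φ + l), ?_, add_sub_cancel _ _⟩
      refine mem_lefschetzDirichlet ω₀ ρ hn hk.le ?_ (sub_mem hα (d_mem_dirichlet ω₀ ρ h5))
      have := sub_mem (sub_mem h h4) (d_mem_lefschetzImage ω₀ hl)
      rw [map_add]
      convert this using 1
      abel
    · intro h1
      obtain ⟨_, ⟨φ, hφ, rfl⟩, l, hl, rfl⟩ := Submodule.mem_sup.1 h1
      obtain ⟨π, hπ, -⟩ := exists_primitive_projection hn ω₀ (k := k) (by omega)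
      obtain ⟨h2, h3⟩ := hπ φ
      refine ⟨(π φ, p), ⟨(mem_delPlus_iff hn ω₀ (by omega)).2 ⟨h2, hp, ?_⟩,
        mem_primitiveDPlus ω₀ ρ hn (by omega) h2 h3 ?_⟩, rfl⟩
      swap
      · change π φ + (φ - π φ) ∈ dirichlet ρ k
        rw [add_sub_cancel]
        exact hφ
      have h4 := d_mem_lefschetzImage ω₀ h3
      have := sub_mem (sub_mem h h4) (lefschetzDirichlet_le_lefschetzImage ω₀ ρ _ hl)
      rw [map_sub] at this
      convert this using 1
      abel

/-- The map is the primitive part. It is onto because every primitive cocycle has a Dirichlet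
representative modulo the image of L. -/
theorem exists_map_relPrimitive (hk : k < n) :
    ∃ p : lefschetzCocycles ω₀ ρ k →ₗ[ℝ] RelPrimitive ω₀ ρ k, Function.Surjective p ∧
      ∀ α, p α = 0 ↔ (α : Form (𝓡∂ m) M k) ∈ relCoboundaries ρ k ⊔ lefschetzDirichlet ω₀ ρ k := by
  obtain ⟨π, hπ, hπ'⟩ := exists_primitive_projection hn ω₀ hk.le
  have hmem : ∀ α ∈ lefschetzCocycles ω₀ ρ k, π α ∈ primCocycles ω₀ ρ k := fun α hα => by
    obtain ⟨h1, h2⟩ := hπ α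
    refine (mem_primCocycles_iff ω₀ ρ hn hk).2
      ⟨mem_primitiveDPlus ω₀ ρ hn hk h1 h2 (by rw [add_sub_cancel]; exact hα.1), ?_⟩
    have h3 : d α ∈ lefschetzImage ω₀ (k + 1) := hα.2
    have h4 := sub_mem h3 (d_mem_lefschetzImage ω₀ h2)
    rwa [map_sub, sub_sub_cancel] at h4
  refine ⟨Submodule.mkQ _ ∘ₗ π.restrict hmem, fun y => ?_, fun α => ?_⟩
  · obtain ⟨⟨η, hη⟩, rfl⟩ := Submodule.mkQ_surjective _ y
    obtain ⟨h1, h2⟩ := (mem_primCocycles_iff ω₀ ρ hn hk).1 hη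
    obtain ⟨l, hl, h3⟩ := exists_add_mem_dirichlet ω₀ ρ hn hk h1
    refine ⟨⟨η + l, h3, ?_⟩, congrArg (Submodule.mkQ _) (Subtype.ext ?_)⟩
    · change d (η + l) ∈ lefschetzImage ω₀ (k + 1)
      rw [map_add]
      exact add_mem h2 (d_mem_lefschetzImage ω₀ hl)
    · refine hπ' (η + l) η h1.1 ?_
      rwa [add_sub_cancel_left]
  · rw [LinearMap.comp_apply, Submodule.mkQ_apply, Submodule.Quotient.mk_eq_zero]
    exact mem_primCoboundaries_iff ω₀ ρ hn hk α.2.1 (hπ _).1 (hπ _).2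

/-- The content is that if a closed form equals an exact term plus ω ∧ σ with σ Dirichlet, then σ is
closed: ω ∧ dσ = 0, and L is injective in the degree of dσ. -/
theorem exists_map_lefschetzCoker : ∀ {k : ℕ}, k < n →
    ∃ r : relCocycles ρ k →ₗ[ℝ] LefschetzCoker ω₀ ρ k, Function.Surjective r ∧
      ∀ x, r x = 0 ↔ (x : Form (𝓡∂ m) M k) ∈ relCoboundaries ρ k ⊔ lefschetzDirichlet ω₀ ρ k := by
  intro k hk
  refine ⟨Submodule.mkQ _ ∘ₗ Submodule.mkQ _,
    (Submodule.mkQ_surjective _).comp (Submodule.mkQ_surjective _), fun x => ?_⟩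
  rw [LinearMap.comp_apply, Submodule.mkQ_apply, Submodule.Quotient.mk_eq_zero]
  match k with
  | 0 =>
    change Submodule.mkQ _ x ∈ (⊥ : Submodule ℝ _) ↔ x.1 ∈ relCoboundaries ρ 0 ⊔ ⊥
    rw [Submodule.mem_bot, sup_bot_eq, Submodule.mkQ_apply, Submodule.Quotient.mk_eq_zero]
    exact Iff.rfl
  | 1 =>
    change Submodule.mkQ _ x ∈ (⊥ : Submodule ℝ _) ↔ x.1 ∈ relCoboundaries ρ 1 ⊔ ⊥
    rw [Submodule.mem_bot, sup_bot_eq, Submodule.mkQ_apply, Submodule.Quotient.mk_eq_zero]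
    exact Iff.rfl
  | k + 2 =>
    constructor
    · rintro ⟨y, hy⟩
      obtain ⟨⟨σ, hσ⟩, rfl⟩ := Submodule.mkQ_surjective _ y
      have h1 := (Submodule.Quotient.eq _).1 hy
      change wedge ω₀.form σ - x.1 ∈ relCoboundaries ρ (k + 2) at h1
      rw [← sub_add_cancel x.1 (wedge ω₀.form σ), ← neg_sub]
      exact Submodule.add_mem_sup (neg_mem h1) ⟨σ, hσ.2, rfl⟩
    · intro h
      obtain ⟨c, hc, _, ⟨σ, hσ, rfl⟩, h1⟩ := Submodule.mem_sup.1 h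
      have hc' : d c = 0 := LinearMap.mem_ker.1 (relCoboundaries_le_relCocycles ρ ω₀ _ hc).1
      have hx : d x.1 = 0 := LinearMap.mem_ker.1 x.2.1
      rw [← h1, map_add, hc', zero_add, d_wedge _ ω₀.closed] at hx
      refine ⟨Submodule.mkQ _ ⟨σ, wedge_injective hn ω₀ (by omega) hx, hσ⟩,
        (Submodule.Quotient.eq _).2 ?_⟩
      change wedge ω₀.form σ - x.1 ∈ relCoboundaries ρ (k + 2)
      rw [← h1, sub_add_cancel_right]
      exact neg_mem hc

/-- The connecting map α ↦ [ξ], dα = ω ∧ ξ. Injectivity of L makes ξ unique and, applied to ω ∧ dξ =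
ddα = 0, closed. The Dirichlet condition passes from dα to ξ, and [ω ∧ ξ] = [dα] = 0. Conversely, ω
∧ ξ = dα with α Dirichlet is exactly what [ξ] in ker L provides. -/
theorem exists_map_lefschetzKer : ∀ {k : ℕ}, k < n →
    ∃ q : lefschetzCocycles ω₀ ρ k →ₗ[ℝ] lefschetzKer ω₀ ρ k, Function.Surjective q ∧
      ∀ α, q α = 0 ↔ ∃ x ∈ relCocycles ρ k,
        (α : Form (𝓡∂ m) M k) - x ∈ lefschetzDirichlet ω₀ ρ k
  | 0, _ => by
    refine ⟨0, fun y => ⟨0, Subtype.ext ((Submodule.mem_bot ℝ).1 y.2).symm⟩, fun α => ?_⟩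
    refine iff_of_true rfl ⟨α, ⟨(Submodule.mem_bot ℝ).1 α.2.2, α.2.1⟩, ?_⟩
    rw [sub_self]
    exact zero_mem _
  | k + 1, hk => by
    have hinj : LinearMap.ker (wedge ω₀.form : Form (𝓡∂ m) M k →ₗ[ℝ] _) = ⊥ :=
      LinearMap.ker_eq_bot'.2 fun η h => wedge_injective hn ω₀ (by omega) h
    let e := LinearEquiv.ofInjective (wedge ω₀.form : Form (𝓡∂ m) M k →ₗ[ℝ] _)
      (LinearMap.ker_eq_bot.1 hinj)
    let D : lefschetzCocycles ω₀ ρ (k + 1) →ₗ[ℝ]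
        LinearMap.range (wedge ω₀.form : Form (𝓡∂ m) M k →ₗ[ℝ] _) :=
      d.restrict fun α hα => hα.2
    have hξ : ∀ α : lefschetzCocycles ω₀ ρ (k + 1), wedge ω₀.form (e.symm (D α)) = d α.1 :=
      fun α => congrArg Subtype.val (e.apply_symm_apply (D α))
    have hmem : ∀ α, (e.symm.toLinearMap ∘ₗ D) α ∈ relCocycles ρ k := fun α => by
      constructor
      · refine wedge_injective hn ω₀ hk ?_
        change wedge ω₀.form (d (e.symm (D α))) = 0
        rw [← d_wedge _ ω₀.closed, hξ, d_d]
      · refine mem_dirichlet_of_wedge ω₀ ρ hn hk ?_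
        change wedge ω₀.form (e.symm (D α)) ∈ _
        rw [hξ]
        exact d_mem_dirichlet ω₀ ρ α.2.1
    let q₀ : lefschetzCocycles ω₀ ρ (k + 1) →ₗ[ℝ] RelDeRham ρ k :=
      Submodule.mkQ _ ∘ₗ (e.symm.toLinearMap ∘ₗ D).codRestrict _ hmem
    have hq₀ : ∀ α, q₀ α ∈ lefschetzKer ω₀ ρ (k + 1) := fun α => by
      refine LinearMap.mem_ker.2 ((Submodule.Quotient.mk_eq_zero _).2 ?_)
      change wedge ω₀.form (e.symm (D α)) ∈ relCoboundaries ρ (k + 2)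
      rw [hξ]
      exact ⟨α.1, α.2.1, rfl⟩
    refine ⟨q₀.codRestrict _ hq₀, fun y => ?_, fun α => ?_⟩
    · obtain ⟨y, hy⟩ := y
      obtain ⟨⟨ξ, hξ'⟩, rfl⟩ := Submodule.mkQ_surjective _ y
      have h1 := (Submodule.Quotient.mk_eq_zero _).1 (LinearMap.mem_ker.1 hy)
      obtain ⟨α, hα, h2⟩ := h1
      change d α = wedge ω₀.form ξ at h2
      refine ⟨⟨α, hα, ξ, h2.symm⟩, Subtype.ext (congrArg (Submodule.mkQ _) (Subtype.ext ?_))⟩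
      change e.symm (D _) = ξ
      rw [LinearEquiv.symm_apply_eq]
      exact Subtype.ext h2
    · have h0 : q₀.codRestrict _ hq₀ α = 0 ↔ e.symm (D α) ∈ relCoboundaries ρ k := by
        rw [← Subtype.val_inj]
        exact Submodule.Quotient.mk_eq_zero _
      rw [h0]
      cases k with
      | zero =>
        constructor
        · intro h
          have h1 := hξ α
          rw [(Submodule.mem_bot ℝ).1 h, map_zero] at h1
          refine ⟨α, ⟨h1.symm, α.2.1⟩, ?_⟩
          rw [sub_self]
          exact zero_mem _
        · rintro ⟨x, hx, h⟩
          have h1 := hξ α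
          rw [sub_eq_zero.1 ((Submodule.mem_bot ℝ).1 h), LinearMap.mem_ker.1 hx.1] at h1
          exact (Submodule.mem_bot ℝ).2 (wedge_injective hn ω₀ (by omega) h1)
      | succ k =>
        constructor
        · rintro ⟨τ, hτ, h⟩
          change d τ = e.symm (D α) at h
          -- Since ξ = dτ, subtracting ω ∧ τ from α makes it closed.
          refine ⟨α.1 - wedge ω₀.form τ, ⟨?_, sub_mem α.2.1 (wedge_mem_dirichlet ω₀ ρ hτ)⟩, ?_⟩
          · change d (α.1 - wedge ω₀.form τ) = 0
            rw [map_sub, d_wedge _ ω₀.closed, h, hξ, sub_self]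
          · rw [sub_sub_cancel]
            exact ⟨τ, hτ, rfl⟩
        · rintro ⟨x, hx, τ, hτ, h⟩
          refine ⟨τ, hτ, sub_eq_zero.1 (wedge_injective hn ω₀ (by omega) ?_)⟩
          have h1 : d x = 0 := LinearMap.mem_ker.1 hx.1
          rw [map_sub, hξ, ← d_wedge _ ω₀.closed, h, map_sub, h1, sub_zero, sub_self]

theorem nonempty_relPrimitive_equiv (hk : k < n) :
    Nonempty (RelPrimitive ω₀ ρ k ≃ₗ[ℝ] (lefschetzKer ω₀ ρ k × LefschetzCoker ω₀ ρ k)) := by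
  obtain ⟨p, hp, hp'⟩ := exists_map_relPrimitive ω₀ ρ hn hk
  obtain ⟨q, hq, hq'⟩ := exists_map_lefschetzKer ω₀ ρ hn hk
  obtain ⟨r, hr, hr'⟩ := exists_map_lefschetzCoker ω₀ ρ hn hk
  -- Closed Dirichlet forms, included in Z, represent the kernel of `q` modulo the kernel of `p`.
  -- The maps `p` and `r` vanish on the same closed forms because both criteria name the same
  -- subspace.
  refine nonempty_equiv_prod p q r (Submodule.inclusion (relCocycles_le_lefschetzCocycles ω₀ ρ))
    hp hq hr (fun z hz => ?_) (fun x => ?_) (fun z hz => ?_) fun x => (hr' x).trans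
      (hp' (Submodule.inclusion (relCocycles_le_lefschetzCocycles ω₀ ρ) x)).symm
  · obtain ⟨c, hc, l, hl, h⟩ := Submodule.mem_sup.1 ((hp' z).1 hz)
    refine (hq' z).2 ⟨c, relCoboundaries_le_relCocycles ρ ω₀ _ hc, ?_⟩
    rwa [← h, add_sub_cancel_left]
  · refine (hq' _).2 ⟨x, x.2, ?_⟩
    rw [Submodule.coe_inclusion, sub_self]
    exact zero_mem _
  · obtain ⟨x, hx, h⟩ := (hq' z).1 hz
    refine ⟨⟨x, hx⟩, ?_⟩
    rw [← sub_eq_zero, ← map_sub]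
    exact (hp' _).2 (Submodule.mem_sup_right h)

end Cohomology

end SymplecticForms

theorem mainTheorem12 {n : ℕ} [NeZero n] {M : Type*} [TopologicalSpace M] [T2Space M]
    [CompactSpace M] [ChartedSpace (EuclideanHalfSpace (2 * n)) M] [IsManifold (𝓡∂ (2 * n)) ∞ M]
    (ω₀ : SymplecticForms.SymplecticForm (𝓡∂ (2 * n)) M)
    (ρ : SymplecticForms.BoundaryDefiningFunction (𝓡∂ (2 * n)) M) (k : ℕ) (hk : k < n) :
    Nonempty (SymplecticForms.RelPrimitive ω₀ ρ k ≃ₗ[ℝ]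
      (SymplecticForms.lefschetzKer ω₀ ρ k × SymplecticForms.LefschetzCoker ω₀ ρ k)) :=
  SymplecticForms.nonempty_relPrimitive_equiv ω₀ ρ (by simp) hk
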